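/- **Setting.** A *ringnet* of valence $m\ge 3$ is a (sufficiently large) quadrilateral mesh with one distinguished central element, a vertex (*primal* ringnet) or a face (*dual* ringnet), of valence $m$; all other vertices and faces have valence $4$. Its vertices are labelled as those of a grid mesh made of $m$ quadrants glued cyclically around the centre. The basic operators are: $R$ splits every face with $k$ vertices at its centre into $k$ quadrilaterals (new vertices: the old vertices, the edge midpoints and the face centres); $A$ produces the dual mesh, whose vertices are the face centres; $V$ produces the mesh that connects the midpoints of adjacent edges. Here the centre of a face is the mean of its vertices. Let $$U=A^{a_s}V^{v_s}R^{r_s}\cdots A^{a_1}V^{v_1}R^{r_1},\qquad a_i,v_i,r_i\ge 0,$$ and put $a=\sum_i a_i$, $v=\sum_i v_i$, $r=\sum_i r_i$. Assume $a+v\ge 1$, $v+r\ge 1$ and that $v$ is even. Let $\mathcal N$ be a ringnet of valence $m$ of the kind (primal or dual) that $U$ produces, so that all $U^k\mathcal N$ are of the same kind, and label the vertices of $U\mathcal N$ like those of $\mathcal N$, preserving the position in the grid mesh. The *core* $\mathcal N_c$ is the set of all vertices of $\mathcal N$ that influence (have nonzero weight in) the central vertex, or a vertex of the central face, of $U^k\mathcal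 N$ for some $k\ge 1$. The *first ring* $\mathcal N_{c.1}$ consists of the vertices outside $\mathcal N_c$ that share a face with a vertex of $\mathcal N_c$. A vertex of $\mathcal N_{c.1}$ is a *convex corner* if exactly one of the faces at it has all its vertices in $\mathcal N_c\cup\mathcal N_{c.1}$. Let $\mathcal N_a$ be the set of convex corners and $\mathcal N_b=\mathcal N_{c.1}\setminus\mathcal N_a$. Let $B$ (respectively $A$) be the diagonal block of the subdivision matrix of $U$ with rows and columns indexed by $\mathcal N_b$ (respectively $\mathcal N_a$), i.e. its entries are the weights of the vertices in $\mathcal N_b$ (respectively $\mathcal N_a$) of $\mathcal N$ in the vertices of $U\mathcal N$ with the same labels. **Lemma (Spectral radii of $B$ and $A$).** The sets $\mathcal N_b$ and $\mathcal N_a$ are finite, and the spectral radii $\rho_B$ and $\rho_A$ of the matrices $B$ and $A$ satisfy $$\rho_B\le 2^{-r-a-v},\qquad \rho_A\le 4^{-r-a}\ \text{ if } v=0,\qquad \rho_A=0\ \text{ if } v>0 .$$ In particular, $\rho_B,\rho_A\le\sigma(U)=2^{-r-v/2}$. -/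

import Mathlib

/-!
# Ringnets and general midpoint subdivision

A ringnet of valence `m` (a quadrilateral mesh whose only extraordinary element is one vertex
or one face of valence `m`) is indexed as a grid mesh: `m` closed quadrants, numbered by `ZMod m`,
glued cyclically along their boundary half-lines.  All vertices, edges and faces of the mesh
are recorded by their centres.  The vertex grid has spacing two, so that every centre has integral
coordinates `(x, y)` in its quadrant.
-/

namespace MidpointSubdivision

/-- The cells (vertices, edges, faces) of a ringnet of valence `m`, given by their centres: the
common centre of all the quadrants, and the point `(i + 1, j)` of the `l`-th quadrant.
The points `(0, y)` with `0 < y` of the `l`-th quadrant are the points `(y, 0)` of the next one. -/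
inductive Cell (m : ℕ) : Type
  | center : Cell m
  | pt (l : ZMod m) (i j : ℕ) : Cell m

namespace Cell

variable {m : ℕ}

/-- The cell with coordinates `(x, y)` in the `l`-th closed quadrant. -/
def mk (l : ZMod m) : ℕ → ℕ → Cell m
  | 0, 0 => center
  | 0, y + 1 => pt (l + 1) y 0
  | x + 1, y => pt l x y

/-- First coordinate. -/
def x : Cell m → ℕ
  | center => 0
  | pt _ i _ => i + 1

/-- Second coordinate. -/
def y : Cell m → ℕ
  | center => 0
  | pt _ _ j => j

/-- The rotation of the ringnet by `k` quadrants. -/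
def turn (k : ZMod m) : Cell m → Cell m
  | center => center
  | pt l i j => pt (l + k) i j

/-- Two cells touch if they lie in a common closed quadrant and their coordinates there differ by
at most one.  A vertex touches precisely itself and the edges and faces that contain it. -/
def Touch (z w : Cell m) : Prop :=
  ∃ (l : ZMod m) (x y x' y' : ℕ), z = mk l x y ∧ w = mk l x' y' ∧
    x ≤ x' + 1 ∧ x' ≤ x + 1 ∧ y ≤ y' + 1 ∧ y' ≤ y + 1

end Cell

/-- A ringnet is primal if its central element is a vertex, dual if it is a face. -/
inductive Kind : Type
  | primal : Kind
  | dual : Kind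

/-- The other kind. -/
def Kind.flip : Kind → Kind
  | .primal => .dual
  | .dual => .primal

variable {m : ℕ}

/-- The cells that are vertices of the ringnet. In a primal ringnet the vertices have
two even coordinates and the faces two odd ones; in a dual ringnet it is the other way round. In both
cases the remaining cells (one even and one odd coordinate) are the edges. -/
def IsVertex : Kind → Cell m → Prop
  | .primal, z => Even z.x ∧ Even z.y
  | .dual, z => Odd z.x ∧ Odd z.y

/-- The cells that are faces of the ringnet. -/
def IsFace (t : Kind) (z : Cell m) : Prop := IsVertex t.flip z

/-- The vertices of a cell: the vertex itself, the two end points of an edge, or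
all the vertices of a face. -/
def vertices (t : Kind) (z : Cell m) : Set (Cell m) := {u | IsVertex t u ∧ Cell.Touch u z}

/-- The midpoint of a cell, where `p u` is the position of the vertex `u`. -/
noncomputable def midpointOf (t : Kind) (p : Cell m → ℝ) (z : Cell m) : ℝ :=
  (∑ᶠ u ∈ vertices t z, p u) / ((vertices t z).ncard : ℝ)

/-! ### The operators `R`, `A` and `V` -/

/-- The three basic operators: refinement `R`, averaging `A`, mid-edge `V`. -/
inductive Op : Type
  | R : Op
  | A : Op
  | V : Op

/-- The kind of the subdivided mesh. `R` keeps a central vertex and turns the centre of a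
central face into a vertex; `A` yields the dual mesh; the faces of the mesh produced by `V` correspond
to the vertices and faces of the given mesh, so there is always a central face. -/
def Op.kind : Op → Kind → Kind
  | .R, _ => .primal
  | .A, t => t.flip
  | .V, _ => .dual

/-- Division of the coordinates by two; the inverse of `R`'s relabelling. -/
def halve : Cell m → Cell m
  | .center => .center
  | .pt l i j => Cell.mk l ((i + 1) / 2) (j / 2)

/-- Rotation by 45 degrees and scaling by `√2`, i.e. `x + iy ↦ (1 + i) (x + iy)`. -/
def spiral : Cell m → Cell m
  | .center => .center
  | .pt l i j =>
    if j ≤ i + 1 then Cell.mk l (i + 1 - j) (i + 1 + j)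
    else Cell.mk (l + 1) (i + 1 + j) (j - (i + 1))

/-- The inverse `x + iy ↦ (x + iy) / (1 + i)` of `spiral`, on cells with `x + y` even. -/
def unspiral : Cell m → Cell m
  | .center => .center
  | .pt l i j =>
    if i + 1 ≤ j then Cell.mk l ((i + 1 + j) / 2) ((j - (i + 1)) / 2)
    else Cell.mk (l - 1) ((i + 1 - j) / 2) ((i + 1 + j) / 2)

theorem halve_double (l : ZMod m) (x y : ℕ) :
    halve (Cell.mk l (2 * x) (2 * y)) = Cell.mk l x y := by
  rcases x with _ | x
  · rcases y with _ | y
    · rfl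
    · have h : (2 * y + 1 + 1) / 2 = y + 1 := by omega
      simp [halve, Cell.mk, Nat.mul_add, h]
  · have h : (2 * x + 1 + 1) / 2 = x + 1 := by omega
    simp [halve, Cell.mk, Nat.mul_add, h]

theorem unspiral_spiral (z : Cell m) : unspiral (spiral z) = z := by
  rcases z with _ | ⟨l, i, j⟩
  · rfl
  · simp only [spiral]
    split_ifs with h
    · rcases Nat.eq_zero_or_pos (i + 1 - j) with h0 | h0
      · have hj : j = i + 1 := by omega
        subst hj
        have h1 : i + 1 + (i + 1) = (2 * i + 1) + 1 := by ring
        have h2 : (2 * i + 1 + 1) / 2 = i + 1 := by omega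
        rw [h0, h1]
        simp [Cell.mk, unspiral, h2]
      · obtain ⟨k, hk⟩ : ∃ k, i + 1 - j = k + 1 := ⟨i - j, by omega⟩
        have h1 : k + 1 ≤ i + 1 + j := by omega
        have h2 : (k + 1 + (i + 1 + j)) / 2 = i + 1 := by omega
        have h3 : (i + 1 + j - (k + 1)) / 2 = j := by omega
        rw [hk]
        simp only [Cell.mk, unspiral, h1, if_true, h2, h3]
    · have h1 : i + 1 + j = (i + j) + 1 := by ring
      have h2 : ¬ (i + j + 1 ≤ j - (i + 1)) := by omega
      have h3 : (i + j + 1 - (j - (i + 1))) / 2 = i + 1 := by omega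
      have h4 : (i + j + 1 + (j - (i + 1))) / 2 = j := by omega
      rw [h1]
      simp only [Cell.mk, unspiral, h2, if_false, h3, h4, add_sub_cancel_right]

/-- The cell of the given mesh at whose midpoint an operator puts the vertex `w` of the new mesh.
* `R` has a new vertex at every vertex, edge midpoint and face centre, and the new grid
  is finer by the factor `2`.
* `A` has a new vertex at every face centre.
* `V` has a new vertex at every edge midpoint, and the new grid is rotated by 45 degrees and finer
  by the factor `√2`. -/
def Op.site : Op → Cell m → Cell m
  | .R => halve
  | .A => id
  | .V => unspiral

/-- Successive application of operators, the head of the list first,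
to a mesh of kind `t` with the vertex positions `p`. -/
noncomputable def applyOps : List Op → Kind → (Cell m → ℝ) → (Cell m → ℝ)
  | [], _, p => p
  | o :: U, t, p => applyOps U (o.kind t) (fun w => midpointOf t p (o.site w))

/-- The kind of the mesh obtained by successive application of operators. -/
def outKind : List Op → Kind → Kind
  | [], t => t
  | o :: U, t => outKind U (o.kind t)

/-- The operator `U = A^{a_s} V^{v_s} R^{r_s} ⋯ A^{a_1} V^{v_1} R^{r_1}`, as the list of its factors
in the order of application (rightmost factor first). -/
def midpointScheme {s : ℕ} (a v r : Fin s → ℕ) : List Op :=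
  (List.finRange s).flatMap fun i =>
    List.replicate (r i) Op.R ++ List.replicate (v i) Op.V ++ List.replicate (a i) Op.A

/-- The number of factors `V`. -/
def numV : List Op → ℕ
  | [] => 0
  | .V :: U => numV U + 1
  | _ :: U => numV U

/-! ### The subdivision matrix and its blocks -/

/-- One subdivision step `N ↦ U N` of ringnets of kind `t`. Each pair of factors `V` has turned the
grid by 90 degrees; turning back gives corresponding vertices of `N` and `U N` the same
label. -/
noncomputable def step (U : List Op) (t : Kind) (p : Cell m → ℝ) : Cell m → ℝ :=
  fun w => applyOps U t p (Cell.turn ((numV U / 2 : ℕ) : ZMod m) w)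

open Classical in
/-- The weight of the vertex `u` of `N` in the vertex `w` of `U^k N`. -/
noncomputable def weight (U : List Op) (t : Kind) (k : ℕ) (w u : Cell m) : ℝ :=
  (step U t)^[k] (Pi.single u 1) w

/-- The core mesh: all vertices of `N` that influence the central vertex or face of `U^k N`
for some `k ≥ 1`. -/
def core (m : ℕ) (U : List Op) (t : Kind) : Set (Cell m) :=
  {u | IsVertex t u ∧ ∃ k : ℕ, 1 ≤ k ∧ ∃ w ∈ vertices t (Cell.center : Cell m),
    weight U t k w u ≠ 0}

/-- The ring of vertices around a set `X` of vertices: the vertices outside of `X` that share a face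
with a vertex of `X`. -/
def ring (t : Kind) (X : Set (Cell m)) : Set (Cell m) :=
  {u | u ∉ X ∧ ∃ z, IsFace t z ∧ u ∈ vertices t z ∧ ∃ x ∈ X, x ∈ vertices t z}

/-- The first ring `N_{c.1}` around the core. -/
def coreRing (m : ℕ) (U : List Op) (t : Kind) : Set (Cell m) := ring t (core m U t)

/-- The convex corners `N_a` of the first ring around the core: the vertices of the ring at
which only one face belongs to the mesh formed by the core and the ring. -/
def convexCorners (m : ℕ) (U : List Op) (t : Kind) : Set (Cell m) :=
  {u | u ∈ coreRing m U t ∧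
    {z : Cell m | IsFace t z ∧ u ∈ vertices t z ∧
      vertices t z ⊆ core m U t ∪ coreRing m U t}.ncard = 1}

/-- The other points `N_b` of the first ring around the core. -/
def nonCorners (m : ℕ) (U : List Op) (t : Kind) : Set (Cell m) :=
  coreRing m U t \ convexCorners m U t

/-- The diagonal block of the subdivision matrix that belongs to the set `X` of vertices: the weights of
the vertices in `X` of `N` in the vertices in `X` of `U N`. -/
noncomputable def subdivisionBlock (U : List Op) (t : Kind) (X : Set (Cell m)) :
    Matrix X X ℝ :=
  Matrix.of fun w u => weight U t 1 w.1 u.1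

/-- The spectral radius of a finite real matrix: the maximal modulus of its complex eigenvalues. -/
noncomputable def matrixSpectralRadius {ι : Type*} [Finite ι] (M : Matrix ι ι ℝ) : ENNReal :=
  letI := Fintype.ofFinite ι
  letI := Classical.decEq ι
  spectralRadius ℂ (M.map ((↑) : ℝ → ℂ))

/-- The scaling factor `σ(U) = 2^{-r-v/2}`. -/
noncomputable def scalingFactor (r v : ℕ) : ℝ := (2 : ℝ) ^ (-(r : ℝ) - (v : ℝ) / 2)

end MidpointSubdivision

open MidpointSubdivision

/-! The core of a ringnet is an octagon; the weights of its first ring halve with every operator. -/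

/-! The influence of an octagon `InOct P Q` (coordinates at most `P`, coordinate sum at most `Q`)
can be followed backwards through the operators: the vertices that influence it under one operator
again fill an octagon, whose parameters are given by `Op.pull`. Starting from the central element,
repeated pulling back by `U` gives an increasing sequence of octagons. It is bounded, because `R`
and `V` shrink the size `max (√2 * P) Q` by the factor `√2 / 2` up to a constant while `A` adds only
a constant. Hence it becomes stationary, and the core is the set of vertices of an octagon fixed by
`pullOps U t` (`exists_core_eq`).

By parity, the first ring lies in the octagon with parameters `P + 2` and `Q + 4`. Its convex
corners are exactly the ring vertices with coordinate sum `Q + 4`, and the others lie within `P + 2`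
and `Q + 2` (`faces_ncard_eq_one`, `faces_ncard_ne_one`).

All weights are nonnegative, so by Gershgorin's theorem the spectral radius of a block is at most
its largest row sum, and the row sums are the values of one step applied to the indicator of the
index set. These values are estimated one operator at a time. A function that is nonpositive on the
inner octagon and at most `C` on the margin of width two becomes at most `C / 2`, since half of the
averaged vertices are inner (`midpointOf_site_le_half`). For the corners, `V` cuts the coordinate
sum back to the margin of the non-corners, so their weights vanish. Without `V` the octagon is a
square (`Q = 2 * P`), only one of the four vertices of a face can be a corner, and the bound is
divided by four (`midpointOf_site_le_quarter`). -/

namespace MidpointSubdivision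

variable {m : ℕ}

/-! ### Coordinates -/

namespace Cell

/-- The larger coordinate. -/
def sup (z : Cell m) : ℕ := max z.x z.y

/-- The sum of the coordinates. -/
def sum (z : Cell m) : ℕ := z.x + z.y

theorem sup_mk (l : ZMod m) (x y : ℕ) : (mk l x y).sup = max x y := by
  rcases x with _ | x <;> rcases y with _ | y <;> simp [mk, sup, Cell.x, Cell.y]

theorem sum_mk (l : ZMod m) (x y : ℕ) : (mk l x y).sum = x + y := by
  rcases x with _ | x <;> rcases y with _ | y <;> simp [mk, sum, Cell.x, Cell.y]

theorem mk_zero_left (l : ZMod m) (y : ℕ) : mk l 0 y = mk (l + 1) y 0 := by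
  rcases y with _ | y <;> rfl

theorem mk_zero_right (l : ZMod m) (x : ℕ) : mk l x 0 = mk (l - 1) 0 x := by
  rw [mk_zero_left, sub_add_cancel]

theorem eq_center_or_mk (z : Cell m) : z = center ∨ ∃ l a b, 1 ≤ a ∧ z = mk l a b := by
  rcases z with _ | ⟨l, i, j⟩
  · exact Or.inl rfl
  · exact Or.inr ⟨l, i + 1, j, by omega, rfl⟩

theorem exists_eq_mk (z : Cell m) : ∃ l a b, z = mk l a b := by
  rcases z with _ | ⟨l, i, j⟩
  · exact ⟨0, 0, 0, rfl⟩
  · exact ⟨l, i + 1, j, rfl⟩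

theorem mk_eq_mk {l k : ZMod m} {a b x y : ℕ} (ha : 1 ≤ a) (h : mk l a b = mk k x y) :
    (k = l ∧ x = a ∧ y = b) ∨ (b = 0 ∧ k = l - 1 ∧ x = 0 ∧ y = a) := by
  obtain ⟨a, rfl⟩ : ∃ c, a = c + 1 := ⟨a - 1, by omega⟩
  rcases x with _ | x
  · rcases y with _ | y
    · simp [mk] at h
    · simp only [mk, pt.injEq] at h
      obtain ⟨rfl, rfl, rfl⟩ := h
      exact Or.inr ⟨rfl, by simp, rfl, rfl⟩
  · simp only [mk, pt.injEq] at h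
    obtain ⟨rfl, rfl, rfl⟩ := h
    exact Or.inl ⟨rfl, rfl, rfl⟩

theorem Touch.symm {z w : Cell m} (h : Touch z w) : Touch w z := by
  obtain ⟨l, x, y, x', y', rfl, rfl, h1, h2, h3, h4⟩ := h
  exact ⟨l, x', y', x, y, rfl, rfl, h2, h1, h4, h3⟩

theorem touch_mk (l : ZMod m) {x y x' y' : ℕ} (h1 : x ≤ x' + 1) (h2 : x' ≤ x + 1)
    (h3 : y ≤ y' + 1) (h4 : y' ≤ y + 1) : Touch (mk l x y) (mk l x' y') :=
  ⟨l, x, y, x', y', rfl, rfl, h1, h2, h3, h4⟩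

theorem Touch.sup_le {z w : Cell m} (h : Touch z w) : z.sup ≤ w.sup + 1 := by
  obtain ⟨l, x, y, x', y', rfl, rfl, h1, h2, h3, h4⟩ := h
  rw [sup_mk, sup_mk]; omega

theorem Touch.sum_le {z w : Cell m} (h : Touch z w) : z.sum ≤ w.sum + 2 := by
  obtain ⟨l, x, y, x', y', rfl, rfl, h1, h2, h3, h4⟩ := h
  rw [sum_mk, sum_mk]; omega

theorem finite_sup_le [NeZero m] (n : ℕ) : {z : Cell m | z.sup ≤ n}.Finite := by
  apply ((Set.finite_univ (α := ZMod m)).prod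
    ((Set.finite_le_nat n).prod (Set.finite_le_nat n))).image (fun a => mk a.1 a.2.1 a.2.2)
    |>.subset
  intro z hz
  obtain ⟨l, a, b, rfl⟩ := exists_eq_mk z
  rw [Set.mem_ofPred_eq, sup_mk] at hz
  exact ⟨(l, a, b), ⟨trivial, by simp; omega, by simp; omega⟩, rfl⟩

/-- The cell with signed coordinates `(x, y)` in the half plane `0 ≤ x` that consists of the
`l`-th quadrant and its predecessor. -/
def signed (l : ZMod m) (x : ℕ) (y : ℤ) : Cell m :=
  if 0 ≤ y then mk l x y.natAbs else mk (l - 1) y.natAbs x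

theorem sup_signed (l : ZMod m) (x : ℕ) (y : ℤ) : (signed l x y).sup = max x y.natAbs := by
  unfold signed
  split_ifs
  · rw [sup_mk]
  · rw [sup_mk, max_comm]

theorem sum_signed (l : ZMod m) (x : ℕ) (y : ℤ) : (signed l x y).sum = x + y.natAbs := by
  unfold signed
  split_ifs
  · rw [sum_mk]
  · rw [sum_mk, add_comm]

theorem signed_natCast (l : ZMod m) (x y : ℕ) : signed l x y = mk l x y := by
  simp [signed]

theorem signed_neg_one (l : ZMod m) (x : ℕ) : signed l x (-1) = mk (l - 1) 1 x := by
  simp [signed]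

theorem touch_signed (l : ZMod m) {x x' y : ℕ} {y' : ℤ} (h1 : x ≤ x' + 1) (h2 : x' ≤ x + 1)
    (h3 : y' ≤ y + 1) (h4 : y ≤ y' + 1) : Touch (signed l x' y') (mk l x y) := by
  unfold signed
  split_ifs with h
  · exact touch_mk l (by omega) (by omega) (by omega) (by omega)
  · obtain rfl : y = 0 := by omega
    rw [mk_zero_right l x]
    exact touch_mk _ (by omega) (by omega) (by omega) (by omega)

theorem one_ne_zero_of_three_le (hm : 3 ≤ m) : (1 : ZMod m) ≠ 0 := by
  have : Fact (1 < m) := ⟨by omega⟩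
  exact one_ne_zero

theorem two_ne_zero_of_three_le (hm : 3 ≤ m) : (2 : ZMod m) ≠ 0 := by
  intro h
  have h2 : ((2 : ℕ) : ZMod m) = 0 := by exact_mod_cast h
  rw [ZMod.natCast_eq_zero_iff] at h2
  have := Nat.le_of_dvd (by norm_num) h2
  omega

theorem mk_inj (hm : 3 ≤ m) {l : ZMod m} {x y x' y' : ℕ} (h : mk l x y = mk l x' y') :
    x = x' ∧ y = y' := by
  have h1 := one_ne_zero_of_three_le hm
  rcases x with _ | x <;> rcases y with _ | y <;> rcases x' with _ | x' <;> rcases y' with _ | y' <;>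
    simp_all [mk]

/-- For valence at least three the quadrants `l - 1`, `l` and `l + 1` are distinct. The last one
matters because a cell `(0, y)` of quadrant `l` is stored in quadrant `l + 1`. -/
theorem mk_ne_mk_sub_one (hm : 3 ≤ m) (l : ZMod m) (x y x' : ℕ) :
    mk l x y ≠ mk (l - 1) 1 x' := by
  have h1 := one_ne_zero_of_three_le hm
  have h2 := two_ne_zero_of_three_le hm
  rcases x with _ | x
  · rcases y with _ | y
    · simp [mk]
    · simp only [mk, ne_eq, pt.injEq, not_and]
      intro h
      exact absurd (by linear_combination h) h2
  · simp only [mk, ne_eq, pt.injEq, not_and]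
    intro h
    exact absurd (by linear_combination h) h1

theorem signed_inj (hm : 3 ≤ m) {l : ZMod m} {x x' : ℕ} {y y' : ℤ} (hy : -1 ≤ y) (hy' : -1 ≤ y')
    (h : signed l x y = signed l x' y') : x = x' ∧ y = y' := by
  have key : ∀ y : ℤ, -1 ≤ y → y = -1 ∨ ∃ n : ℕ, y = n := fun y hy => by
    rcases Int.lt_or_le y 0 with h | h
    · left; omega
    · right; exact ⟨y.toNat, by omega⟩
  rcases key y hy with rfl | ⟨n, rfl⟩ <;> rcases key y' hy' with rfl | ⟨n', rfl⟩
  · rw [signed_neg_one, signed_neg_one] at h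
    exact ⟨(mk_inj hm h).2, rfl⟩
  · rw [signed_neg_one, signed_natCast] at h
    exact absurd h.symm (mk_ne_mk_sub_one hm _ _ _ _)
  · rw [signed_neg_one, signed_natCast] at h
    exact absurd h (mk_ne_mk_sub_one hm _ _ _ _)
  · rw [signed_natCast, signed_natCast] at h
    obtain ⟨h1, h2⟩ := mk_inj hm h
    exact ⟨h1, by rw [h2]⟩

theorem sup_turn (k : ZMod m) (z : Cell m) : (turn k z).sup = z.sup := by
  rcases z with _ | ⟨l, i, j⟩ <;> rfl

theorem sum_turn (k : ZMod m) (z : Cell m) : (turn k z).sum = z.sum := by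
  rcases z with _ | ⟨l, i, j⟩ <;> rfl

theorem turn_turn_neg (k : ZMod m) (z : Cell m) : turn k (turn (-k) z) = z := by
  rcases z with _ | ⟨l, i, j⟩ <;> simp [turn]

end Cell

open Cell

/-- The parity of the coordinates of the vertices. -/
def Kind.parity : Kind → ℕ
  | .primal => 0
  | .dual => 1

theorem Kind.parity_flip (t : Kind) : t.flip.parity = 1 - t.parity := by
  rcases t <;> rfl

theorem Kind.parity_le (t : Kind) : t.parity ≤ 1 := by
  rcases t <;> decide

theorem isVertex_iff (t : Kind) (z : Cell m) :
    IsVertex t z ↔ z.x % 2 = t.parity ∧ z.y % 2 = t.parity := by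
  rcases t <;> simp [IsVertex, Kind.parity, Nat.even_iff, Nat.odd_iff]

theorem isVertex_mk (t : Kind) (l : ZMod m) (x y : ℕ) :
    IsVertex t (mk l x y) ↔ x % 2 = t.parity ∧ y % 2 = t.parity := by
  rw [isVertex_iff]
  rcases x with _ | x <;> rcases y with _ | y <;> simp [mk, Cell.x, Cell.y, and_comm]

theorem isVertex_signed (t : Kind) (l : ZMod m) (x : ℕ) (y : ℤ) :
    IsVertex t (signed l x y) ↔ x % 2 = t.parity ∧ y.natAbs % 2 = t.parity := by
  unfold signed
  split_ifs
  · rw [isVertex_mk]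
  · rw [isVertex_mk, and_comm]

theorem isVertex_turn (t : Kind) (k : ZMod m) (z : Cell m) :
    IsVertex t (turn k z) ↔ IsVertex t z := by
  rw [isVertex_iff, isVertex_iff]
  rcases z with _ | ⟨l, i, j⟩ <;> rfl

/-! ### Vertices of a cell -/

/-- The integers of the parity of `t` at distance at most one from `b`. -/
def near (t : Kind) (b : ℤ) : Finset ℤ :=
  if b % 2 = t.parity then {b} else {b - 1, b + 1}

theorem mem_near {t : Kind} {b c : ℤ} :
    c ∈ near t b ↔ c % 2 = t.parity ∧ c ≤ b + 1 ∧ b ≤ c + 1 := by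
  have := t.parity_le
  unfold near
  split_ifs with h
  · rw [Finset.mem_singleton]
    constructor <;> intro <;> omega
  · rw [Finset.mem_insert, Finset.mem_singleton]
    constructor <;> intro <;> omega

theorem finite_vertices [NeZero m] (t : Kind) (z : Cell m) : (vertices t z).Finite :=
  (finite_sup_le (z.sup + 1)).subset fun _ hu => hu.2.sup_le

/-- With `1 ≤ a` every neighbour lies in the half plane of quadrants `l - 1` and `l`, where signed
coordinates make the mesh an ordinary grid. Only the second coordinate can become negative, namely
`-1` when `b = 0`. -/
theorem vertices_mk (t : Kind) (l : ZMod m) {a : ℕ} (ha : 1 ≤ a) (b : ℕ) :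
    vertices t (mk l a b) = (fun c : ℤ × ℤ => signed l c.1.natAbs c.2) ''
      (near t a ×ˢ near t b : Finset (ℤ × ℤ)) := by
  ext u
  constructor
  · rintro ⟨hu, k, x, y, x', y', rfl, hz, h1, h2, h3, h4⟩
    rw [isVertex_mk] at hu
    rcases mk_eq_mk ha hz with ⟨rfl, rfl, rfl⟩ | ⟨rfl, rfl, rfl, rfl⟩
    · refine ⟨((x : ℤ), (y : ℤ)), ?_, by simp [signed_natCast]⟩
      simp only [Finset.coe_product, Set.mem_prod, Finset.mem_coe, mem_near]
      omega
    · obtain rfl | rfl : x = 0 ∨ x = 1 := by omega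
      · refine ⟨((y : ℤ), ((0 : ℕ) : ℤ)), ?_, ?_⟩
        · simp only [Finset.coe_product, Set.mem_prod, Finset.mem_coe, mem_near]
          omega
        · simp only [signed_natCast, Int.natAbs_natCast]
          rw [mk_zero_right]
      · refine ⟨((y : ℤ), -1), ?_, by simp [signed_neg_one]⟩
        simp only [Finset.coe_product, Set.mem_prod, Finset.mem_coe, mem_near]
        omega
  · rintro ⟨⟨x, y⟩, hc, rfl⟩
    simp only [Finset.coe_product, Set.mem_prod, Finset.mem_coe, mem_near] at hc
    obtain ⟨⟨hx, hx1, hx2⟩, hy, hy1, hy2⟩ := hc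
    refine ⟨(isVertex_signed _ _ _ _).2 ⟨by simp only; omega, by simp only; omega⟩, ?_⟩
    exact touch_signed l (by simp only; omega) (by simp only; omega) hy1 hy2

theorem mem_vertices_mk {t : Kind} {l : ZMod m} {a : ℕ} (ha : 1 ≤ a) {b : ℕ} {u : Cell m} :
    u ∈ vertices t (mk l a b) ↔
      ∃ c ∈ near t a, ∃ d ∈ near t b, u = signed l c.natAbs d := by
  rw [vertices_mk t l ha]
  constructor
  · rintro ⟨⟨c, d⟩, hc, rfl⟩
    simp only [Finset.coe_product, Set.mem_prod, Finset.mem_coe] at hc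
    exact ⟨c, hc.1, d, hc.2, rfl⟩
  · rintro ⟨c, hc, d, hd, rfl⟩
    exact ⟨(c, d), by simp [hc, hd], rfl⟩

theorem injOn_signed (hm : 3 ≤ m) (t : Kind) (l : ZMod m) {a : ℕ} (ha : 1 ≤ a) (b : ℕ) :
    Set.InjOn (fun c : ℤ × ℤ => signed l c.1.natAbs c.2)
      (near t a ×ˢ near t b : Finset (ℤ × ℤ)) := by
  rintro ⟨x, y⟩ h ⟨x', y'⟩ h' hh
  simp only [Finset.coe_product, Set.mem_prod, Finset.mem_coe, mem_near] at h h'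
  obtain ⟨h1, h2⟩ := signed_inj hm (by omega) (by omega) hh
  exact Prod.ext (by simp only; omega) h2

/-- The mean of a function on the integers of the parity of `t` at distance at most one from `b`. -/
noncomputable def nearMean (t : Kind) (b : ℤ) (f : ℤ → ℝ) : ℝ :=
  (∑ c ∈ near t b, f c) / (near t b).card

theorem nearMean_of_not_parity {t : Kind} {b : ℤ} (h : b % 2 ≠ t.parity) (f : ℤ → ℝ) :
    nearMean t b f = (f (b - 1) + f (b + 1)) / 2 := by
  have h1 : b - 1 ≠ b + 1 := by omega
  simp [nearMean, near, h, Finset.sum_pair h1, Finset.card_pair h1]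

/-- The product structure of the vertex set turns the midpoint into an iterated one-dimensional
mean, so that later bounds can use one direction at a time. -/
theorem midpointOf_mk (hm : 3 ≤ m) (t : Kind) (p : Cell m → ℝ) (l : ZMod m) {a : ℕ} (ha : 1 ≤ a)
    (b : ℕ) : midpointOf t p (mk l a b) =
      nearMean t a fun c => nearMean t b fun d => p (signed l c.natAbs d) := by
  have hinj := injOn_signed hm t l ha b
  unfold midpointOf
  rw [vertices_mk t l ha b, hinj.ncard_image, Set.ncard_coe_finset,
    finsum_mem_image hinj, finsum_mem_coe_finset, Finset.sum_product, Finset.card_product]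
  simp only [nearMean, Finset.sum_div, Nat.cast_mul]
  refine Finset.sum_congr rfl fun c _ => Finset.sum_congr rfl fun d _ => ?_
  rw [div_div, mul_comm]

theorem midpointOf_eq_sum [NeZero m] (t : Kind) (p : Cell m → ℝ) (z : Cell m) :
    midpointOf t p z =
      (∑ u ∈ (finite_vertices t z).toFinset, p u) / ((vertices t z).ncard : ℝ) := by
  rw [midpointOf, finsum_mem_eq_finite_toFinset_sum]

theorem midpointOf_nonneg [NeZero m] {t : Kind} {p : Cell m → ℝ} (z : Cell m)
    (h : ∀ u, 0 ≤ p u) : 0 ≤ midpointOf t p z := by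
  rw [midpointOf_eq_sum]
  exact div_nonneg (Finset.sum_nonneg fun u _ => h u) (Nat.cast_nonneg _)

theorem midpointOf_pos [NeZero m] {t : Kind} {p : Cell m → ℝ} {z u : Cell m}
    (h : ∀ u, 0 ≤ p u) (hu : u ∈ vertices t z) (hp : 0 < p u) : 0 < midpointOf t p z := by
  rw [midpointOf_eq_sum]
  refine div_pos (Finset.sum_pos' (fun u _ => h u) ⟨u, by simpa using hu, hp⟩) ?_
  exact_mod_cast (Set.ncard_pos (finite_vertices t z)).2 ⟨u, hu⟩

theorem midpointOf_sum [NeZero m] {ι : Type*} (s : Finset ι) (t : Kind) (p : ι → Cell m → ℝ)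
    (z : Cell m) :
    midpointOf t (fun u => ∑ i ∈ s, p i u) z = ∑ i ∈ s, midpointOf t (p i) z := by
  simp only [midpointOf_eq_sum, ← Finset.sum_div]
  rw [Finset.sum_comm]

theorem applyOps_nonneg [NeZero m] (U : List Op) (t : Kind) {p : Cell m → ℝ} (h : ∀ u, 0 ≤ p u)
    (w : Cell m) : 0 ≤ applyOps U t p w := by
  induction U generalizing t p with
  | nil => exact h w
  | cons o U ih => exact ih _ fun u => midpointOf_nonneg _ h

theorem applyOps_sum [NeZero m] {ι : Type*} (s : Finset ι) (U : List Op) (t : Kind)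
    (p : ι → Cell m → ℝ) (w : Cell m) :
    applyOps U t (fun u => ∑ i ∈ s, p i u) w = ∑ i ∈ s, applyOps U t (p i) w := by
  induction U generalizing t p with
  | nil => rfl
  | cons o U ih =>
    simp only [applyOps]
    rw [← ih]
    congr 1
    funext u
    exact midpointOf_sum _ _ _ _

/-! ### Octagons -/

/-- The octagon of the cells with coordinates at most `P` and sum of coordinates at most `Q`. -/
def InOct (P Q : ℕ) (z : Cell m) : Prop := z.sup ≤ P ∧ z.sum ≤ Q

/-- The octagon with parameters `P` and `Q` has vertices of kind `t` on all its sides. -/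
structure Tight (t : Kind) (P Q : ℕ) : Prop where
  parity : P % 2 = t.parity
  even : Q % 2 = 0
  le : P ≤ Q
  le_two_mul : Q ≤ 2 * P

/-- The least number `≥ n` of the parity of `t`. -/
def Kind.ceil (t : Kind) (n : ℕ) : ℕ := n + (n + t.parity) % 2

/-- The parameters of the octagon of the vertices of kind `t` that influence the octagon with
the given parameters under the operator `o`. -/
def Op.pull : Op → Kind → ℕ × ℕ → ℕ × ℕ
  | .A, _, c => (c.1 + 1, c.2 + 2)
  | .R, t, c => (t.ceil (c.1 / 2),
      min (2 * t.ceil (c.1 / 2)) (c.2 / 2 + 2 - c.2 / 2 % 2))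
  | .V, t, c => (t.ceil (c.2 / 2), c.1 + 1)

/-- The parameters of the octagon of the vertices that influence the octagon with the
given parameters under the successive application of operators. -/
def pullOps : List Op → Kind → ℕ × ℕ → ℕ × ℕ
  | [], _, c => c
  | o :: U, t, c => o.pull t (pullOps U (o.kind t) c)

/-- The minimum in the `R` case of `Op.pull` is needed here: the primal octagon `(0, 0)` would
otherwise get the sum bound `2`, beyond the corner of its square. -/
theorem Tight.pull {o : Op} {t : Kind} {c : ℕ × ℕ} (h : Tight (o.kind t) c.1 c.2) :
    Tight t (o.pull t c).1 (o.pull t c).2 := by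
  obtain ⟨h1, h2, h3, h4⟩ := h
  rcases o <;> rcases t <;>
    simp only [Op.kind, Kind.flip, Kind.parity, Op.pull, Kind.ceil] at * <;>
    constructor <;> (try simp only [Kind.parity]) <;> omega

theorem Tight.pullOps {U : List Op} {t : Kind} {c : ℕ × ℕ} (h : Tight (outKind U t) c.1 c.2) :
    Tight t (pullOps U t c).1 (pullOps U t c).2 := by
  induction U generalizing t with
  | nil => exact h
  | cons o U ih => exact Tight.pull (ih h)

/-! ### Sites -/

/-- The coordinates `(a, b)` belong to a cell of which `o` takes the midpoint. -/
def Op.IsSite : Op → Kind → ℕ → ℕ → Prop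
  | .A, t, a, b => a % 2 ≠ t.parity ∧ b % 2 ≠ t.parity
  | .R, _, _, _ => True
  | .V, _, a, b => (a + b) % 2 = 1

/-- The new vertex at the midpoint of a cell with the coordinates `(a, b)` belongs to the octagon
with the parameters `P` and `Q`. -/
def Op.SiteInOct : Op → ℕ → ℕ → ℕ → ℕ → Prop
  | .A, P, Q, a, b => a ≤ P ∧ b ≤ P ∧ a + b ≤ Q
  | .R, P, Q, a, b => 2 * a ≤ P ∧ 2 * b ≤ P ∧ 2 * (a + b) ≤ Q
  | .V, P, Q, a, b => a + b ≤ P ∧ 2 * a ≤ Q ∧ 2 * b ≤ Q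

theorem inOct_mk (P Q : ℕ) (l : ZMod m) (a b : ℕ) :
    InOct P Q (mk l a b) ↔ a ≤ P ∧ b ≤ P ∧ a + b ≤ Q := by
  rw [InOct, sup_mk, sum_mk]; omega

theorem inOct_signed (P Q : ℕ) (l : ZMod m) (a : ℕ) (b : ℤ) :
    InOct P Q (signed l a b) ↔ a ≤ P ∧ b.natAbs ≤ P ∧ a + b.natAbs ≤ Q := by
  rw [InOct, sup_signed, sum_signed]; omega

theorem inOct_turn (P Q : ℕ) (k : ZMod m) (z : Cell m) : InOct P Q (turn k z) ↔ InOct P Q z := by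
  rw [InOct, InOct, sup_turn, sum_turn]

theorem inOct_center (P Q : ℕ) : InOct P Q (center : Cell m) := by
  constructor <;> simp [sup, sum, Cell.x, Cell.y]

theorem site_eq_mk (o : Op) (t : Kind) {w : Cell m} (hw : IsVertex (o.kind t) w)
    (hc : w ≠ center) :
    ∃ l a b, 1 ≤ a ∧ o.site w = mk l a b ∧ o.IsSite t a b ∧
      ∀ P Q, InOct P Q w ↔ o.SiteInOct P Q a b := by
  rcases w with _ | ⟨l, i, j⟩
  · exact absurd rfl hc
  have hw' : IsVertex (o.kind t) (mk l (i + 1) j) := hw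
  have hio : ∀ P Q, InOct P Q (pt l i j) ↔ i + 1 ≤ P ∧ j ≤ P ∧ i + 1 + j ≤ Q :=
    fun P Q => inOct_mk P Q l (i + 1) j
  rw [isVertex_mk] at hw'
  simp only [hio]
  rcases o with _ | _ | _
  · simp only [Op.kind, Kind.parity] at hw'
    exact ⟨l, (i + 1) / 2, j / 2, by omega, rfl, trivial,
      fun P Q => by simp only [Op.SiteInOct]; omega⟩
  · simp only [Op.kind, Kind.parity_flip] at hw'
    have := t.parity_le
    exact ⟨l, i + 1, j, by omega, rfl, ⟨by omega, by omega⟩, fun P Q => Iff.rfl⟩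
  · simp only [Op.kind, Kind.parity] at hw'
    by_cases h : i + 1 ≤ j
    · exact ⟨l, (i + 1 + j) / 2, (j - (i + 1)) / 2, by omega, by simp [Op.site, unspiral, h],
        by simp only [Op.IsSite]; omega, fun P Q => by simp only [Op.SiteInOct]; omega⟩
    · exact ⟨l - 1, (i + 1 - j) / 2, (i + 1 + j) / 2, by omega, by simp [Op.site, unspiral, h],
        by simp only [Op.IsSite]; omega, fun P Q => by simp only [Op.SiteInOct]; omega⟩

theorem site_center (o : Op) : o.site (center : Cell m) = center := by
  rcases o <;> rfl

theorem exists_site_eq_mk (o : Op) (t : Kind) (l : ZMod m) {a b : ℕ} (h : o.IsSite t a b) :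
    ∃ w : Cell m, IsVertex (o.kind t) w ∧ o.site w = mk l a b ∧
      ∀ P Q, InOct P Q w ↔ o.SiteInOct P Q a b := by
  rcases o with _ | _ | _
  · refine ⟨mk l (2 * a) (2 * b), ?_, halve_double l a b, fun P Q => ?_⟩
    · rw [isVertex_mk]; simp only [Op.kind, Kind.parity]; omega
    · rw [inOct_mk]; simp only [Op.SiteInOct]; omega
  · refine ⟨mk l a b, ?_, rfl, fun P Q => inOct_mk P Q l a b⟩
    have := t.parity_le
    obtain ⟨h1, h2⟩ := h
    rw [isVertex_mk]; simp only [Op.kind, Kind.parity_flip]; omega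
  · simp only [Op.IsSite] at h
    -- `spiral` is defined through `pt`, so a site with `a = 0` is first moved to the next quadrant.
    -- This swaps its coordinates, in which the conditions are symmetric.
    obtain ⟨l, a, b, h, hmk, hio⟩ : ∃ k i j, (i + 1 + j) % 2 = 1 ∧ mk l a b = pt k i j ∧
        ∀ P Q, Op.V.SiteInOct P Q a b ↔ Op.V.SiteInOct P Q (i + 1) j := by
      rcases a with _ | a
      · obtain ⟨b, rfl⟩ : ∃ c, b = c + 1 := ⟨b - 1, by omega⟩
        exact ⟨l + 1, b, 0, by omega, rfl, fun P Q => by simp only [Op.SiteInOct]; omega⟩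
      · exact ⟨l, a, b, h, rfl, fun P Q => Iff.rfl⟩
    rw [hmk]
    refine ⟨spiral (pt l a b), ?_, unspiral_spiral _, fun P Q => ?_⟩
    · rw [spiral]
      split_ifs <;> rw [isVertex_mk] <;> simp only [Op.kind, Kind.parity] <;> omega
    · rw [hio, spiral]
      split_ifs <;> rw [inOct_mk] <;> simp only [Op.SiteInOct] <;> omega

/-! ### Vertices of sites in octagons -/

/-- This is where the values of `Op.pull` come from. `A` moves both coordinates by one. Under `R`
the bounds are halved and then rounded to the parity. `V` turns the grid by 45 degrees, so the
bounds on coordinates and on their sum trade places, and only one coordinate of an edge changes at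
its end points. -/
theorem near_inOct {o : Op} {t : Kind} {P Q a b : ℕ} (h : Tight (o.kind t) P Q)
    (hs : o.IsSite t a b) (ho : o.SiteInOct P Q a b) (ha : 1 ≤ a) {c d : ℤ}
    (hc : c ∈ near t a) (hd : d ∈ near t b) :
    c.natAbs ≤ (o.pull t (P, Q)).1 ∧ d.natAbs ≤ (o.pull t (P, Q)).1 ∧ c.natAbs + d.natAbs ≤ (o.pull t (P, Q)).2 := by
  have hx : c.natAbs ≤ (o.pull t (P, Q)).1 := by
    obtain ⟨h1, h2, h3, h4⟩ := h
    rw [mem_near] at hc hd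
    rcases o <;> rcases t <;>
      simp only [Op.kind, Kind.flip, Kind.parity, Op.pull, Kind.ceil, Op.IsSite,
        Op.SiteInOct] at * <;>
      omega
  have hy : d.natAbs ≤ (o.pull t (P, Q)).1 := by
    obtain ⟨h1, h2, h3, h4⟩ := h
    rw [mem_near] at hc hd
    rcases o <;> rcases t <;>
      simp only [Op.kind, Kind.flip, Kind.parity, Op.pull, Kind.ceil, Op.IsSite,
        Op.SiteInOct] at * <;>
      omega
  refine ⟨hx, hy, ?_⟩
  obtain ⟨h1, h2, h3, h4⟩ := h
  rw [mem_near] at hc hd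
  rcases o <;> rcases t <;>
    simp only [Op.kind, Kind.flip, Kind.parity, Op.pull, Kind.ceil, Op.IsSite,
      Op.SiteInOct] at * <;>
    omega

/-- No operator widens the margin: `A` keeps it, `R` halves it, `V` exchanges its two parts with
scaling, and rounding to the parity costs no more than the gain. -/
theorem near_inOct_two {o : Op} {t : Kind} {P Q a b : ℕ} (h : Tight (o.kind t) P Q)
    (hs : o.IsSite t a b) (ho : o.SiteInOct (P + 2) (Q + 2) a b) (ha : 1 ≤ a) {c d : ℤ}
    (hc : c ∈ near t a) (hd : d ∈ near t b) :
    c.natAbs ≤ (o.pull t (P, Q)).1 + 2 ∧ d.natAbs ≤ (o.pull t (P, Q)).1 + 2 ∧ c.natAbs + d.natAbs ≤ (o.pull t (P, Q)).2 + 2 := by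
  have hx : c.natAbs ≤ (o.pull t (P, Q)).1 + 2 := by
    obtain ⟨h1, h2, h3, h4⟩ := h
    rw [mem_near] at hc hd
    rcases o <;> rcases t <;>
      simp only [Op.kind, Kind.flip, Kind.parity, Op.pull, Kind.ceil, Op.IsSite,
        Op.SiteInOct] at * <;>
      omega
  have hy : d.natAbs ≤ (o.pull t (P, Q)).1 + 2 := by
    obtain ⟨h1, h2, h3, h4⟩ := h
    rw [mem_near] at hc hd
    rcases o <;> rcases t <;>
      simp only [Op.kind, Kind.flip, Kind.parity, Op.pull, Kind.ceil, Op.IsSite,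
        Op.SiteInOct] at * <;>
      omega
  refine ⟨hx, hy, ?_⟩
  obtain ⟨h1, h2, h3, h4⟩ := h
  rw [mem_near] at hc hd
  rcases o <;> rcases t <;>
    simp only [Op.kind, Kind.flip, Kind.parity, Op.pull, Kind.ceil, Op.IsSite,
      Op.SiteInOct] at * <;>
    omega

theorem near_inOct_four {o : Op} {t : Kind} {P Q a b : ℕ} (h : Tight (o.kind t) P Q)
    (hs : o.IsSite t a b) (ho : o.SiteInOct (P + 2) (Q + 4) a b) (ha : 1 ≤ a) {c d : ℤ}
    (hc : c ∈ near t a) (hd : d ∈ near t b) :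
    c.natAbs ≤ (o.pull t (P, Q)).1 + 2 ∧ d.natAbs ≤ (o.pull t (P, Q)).1 + 2 ∧ c.natAbs + d.natAbs ≤ (o.pull t (P, Q)).2 + 4 := by
  have hx : c.natAbs ≤ (o.pull t (P, Q)).1 + 2 := by
    obtain ⟨h1, h2, h3, h4⟩ := h
    rw [mem_near] at hc hd
    rcases o <;> rcases t <;>
      simp only [Op.kind, Kind.flip, Kind.parity, Op.pull, Kind.ceil, Op.IsSite,
        Op.SiteInOct] at * <;>
      omega
  have hy : d.natAbs ≤ (o.pull t (P, Q)).1 + 2 := by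
    obtain ⟨h1, h2, h3, h4⟩ := h
    rw [mem_near] at hc hd
    rcases o <;> rcases t <;>
      simp only [Op.kind, Kind.flip, Kind.parity, Op.pull, Kind.ceil, Op.IsSite,
        Op.SiteInOct] at * <;>
      omega
  refine ⟨hx, hy, ?_⟩
  obtain ⟨h1, h2, h3, h4⟩ := h
  rw [mem_near] at hc hd
  rcases o <;> rcases t <;>
    simp only [Op.kind, Kind.flip, Kind.parity, Op.pull, Kind.ceil, Op.IsSite,
      Op.SiteInOct] at * <;>
    omega

/-- After `V` the margin of the sum stems from the margin `2` of the coordinates, so the excess `4`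
at the corners is lost. -/
theorem near_inOct_of_V {t : Kind} {P Q a b : ℕ} (h : Tight (Op.V.kind t) P Q)
    (hs : Op.V.IsSite t a b) (ho : Op.V.SiteInOct (P + 2) (Q + 4) a b) (ha : 1 ≤ a) {c d : ℤ}
    (hc : c ∈ near t a) (hd : d ∈ near t b) :
    c.natAbs + d.natAbs ≤ (Op.V.pull t (P, Q)).2 + 2 := by
  obtain ⟨h1, h2, h3, h4⟩ := h
  rw [mem_near] at hc hd
  rcases t <;>
    simp only [Op.kind, Kind.parity, Op.pull, Kind.ceil, Op.IsSite, Op.SiteInOct] at * <;>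
    omega

theorem near_inOct_of_inner {o : Op} {t : Kind} {P Q a b : ℕ} (h : Tight (o.kind t) P Q)
    (hs : o.IsSite t a b) (ho : o.SiteInOct (P + 2) (Q + 2) a b) (ha : 1 ≤ a) {c d : ℤ}
    (hc : c ∈ near t a) (hd : d ∈ near t b)
    (hcd : (c = a ∧ d = b) ∨ (c = a ∧ d = b - 1) ∨
      (c = a - 1 ∧ ((b : ℤ) % 2 = t.parity ∨ b ≤ a)) ∨ (d = b - 1 ∧ a < b)) :
    c.natAbs ≤ (o.pull t (P, Q)).1 ∧ d.natAbs ≤ (o.pull t (P, Q)).1 ∧ c.natAbs + d.natAbs ≤ (o.pull t (P, Q)).2 := by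
  have hx : c.natAbs ≤ (o.pull t (P, Q)).1 := by
    obtain ⟨h1, h2, h3, h4⟩ := h
    rw [mem_near] at hc hd
    rcases o <;> rcases t <;>
      simp only [Op.kind, Kind.flip, Kind.parity, Op.pull, Kind.ceil, Op.IsSite,
        Op.SiteInOct] at * <;>
      rcases hcd with ⟨rfl, rfl⟩ | ⟨rfl, rfl⟩ | ⟨rfl, hcd⟩ | ⟨rfl, hcd⟩ <;>
      omega
  have hy : d.natAbs ≤ (o.pull t (P, Q)).1 := by
    obtain ⟨h1, h2, h3, h4⟩ := h
    rw [mem_near] at hc hd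
    rcases o <;> rcases t <;>
      simp only [Op.kind, Kind.flip, Kind.parity, Op.pull, Kind.ceil, Op.IsSite,
        Op.SiteInOct] at * <;>
      rcases hcd with ⟨rfl, rfl⟩ | ⟨rfl, rfl⟩ | ⟨rfl, hcd⟩ | ⟨rfl, hcd⟩ <;>
      omega
  refine ⟨hx, hy, ?_⟩
  obtain ⟨h1, h2, h3, h4⟩ := h
  rw [mem_near] at hc hd
  rcases o <;> rcases t <;>
    simp only [Op.kind, Kind.flip, Kind.parity, Op.pull, Kind.ceil, Op.IsSite,
      Op.SiteInOct] at * <;>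
    rcases hcd with ⟨rfl, rfl⟩ | ⟨rfl, rfl⟩ | ⟨rfl, hcd⟩ | ⟨rfl, hcd⟩ <;>
    omega

/-- Of the vertices of a site close to the octagon, half are in the octagon: those on the side of the
centre in one of the two directions. -/
theorem half_near_inOct {o : Op} {t : Kind} {P Q a b : ℕ} (h : Tight (o.kind t) P Q)
    (hs : o.IsSite t a b) (ho : o.SiteInOct (P + 2) (Q + 2) a b) (ha : 1 ≤ a) :
    ((a : ℤ) % 2 ≠ t.parity ∧ ∀ c ∈ near t a, c ≤ a → ∀ d ∈ near t b,
      c.natAbs ≤ (o.pull t (P, Q)).1 ∧ d.natAbs ≤ (o.pull t (P, Q)).1 ∧ c.natAbs + d.natAbs ≤ (o.pull t (P, Q)).2) ∨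
    ((b : ℤ) % 2 ≠ t.parity ∧ ∀ c ∈ near t a, ∀ d ∈ near t b, d ≤ b →
      c.natAbs ≤ (o.pull t (P, Q)).1 ∧ d.natAbs ≤ (o.pull t (P, Q)).1 ∧ c.natAbs + d.natAbs ≤ (o.pull t (P, Q)).2) ∨
    ∀ c ∈ near t a, ∀ d ∈ near t b,
      c.natAbs ≤ (o.pull t (P, Q)).1 ∧ d.natAbs ≤ (o.pull t (P, Q)).1 ∧ c.natAbs + d.natAbs ≤ (o.pull t (P, Q)).2 := by
  simp only [mem_near]
  by_cases hat : (a : ℤ) % 2 = t.parity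
  · by_cases hbt : (b : ℤ) % 2 = t.parity
    · refine Or.inr (Or.inr fun c hc d hd => ?_)
      obtain rfl : c = a := by omega
      obtain rfl : d = b := by omega
      exact near_inOct_of_inner h hs ho ha (mem_near.2 hc) (mem_near.2 hd) (by omega)
    · refine Or.inr (Or.inl ⟨hbt, fun c hc d hd hdb => ?_⟩)
      obtain rfl : c = a := by omega
      obtain rfl : d = b - 1 := by omega
      exact near_inOct_of_inner h hs ho ha (mem_near.2 hc) (mem_near.2 hd) (by omega)
  -- At a face the larger coordinate has to decrease. The smaller one may grow, because `Q ≤ 2 * P`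
  -- keeps it away from the side.
  · by_cases hab : (b : ℤ) % 2 = t.parity ∨ b ≤ a
    · refine Or.inl ⟨hat, fun c hc hca d hd => ?_⟩
      obtain rfl : c = a - 1 := by omega
      exact near_inOct_of_inner h hs ho ha (mem_near.2 hc) (mem_near.2 hd) (by omega)
    · refine Or.inr (Or.inl ⟨by omega, fun c hc d hd hdb => ?_⟩)
      obtain rfl : d = b - 1 := by omega
      exact near_inOct_of_inner h hs ho ha (mem_near.2 hc) (mem_near.2 hd) (by omega)

/-- Only the outermost vertex of a face, with both coordinates increased, can be a corner. -/
theorem near_inOct_of_square {o : Op} {t : Kind} {P a b : ℕ} (hV : o ≠ .V)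
    (h : Tight (o.kind t) P (2 * P)) (hs : o.IsSite t a b)
    (ho : o.SiteInOct (P + 2) (2 * P + 4) a b) (ha : 1 ≤ a) {c d : ℤ}
    (hc : c ∈ near t a) (hd : d ∈ near t b)
    (hcd : c ≤ a ∨ d ≤ b) : c.natAbs + d.natAbs ≤ (o.pull t (P, 2 * P)).2 + 2 := by
  obtain ⟨h1, h2, h3, h4⟩ := h
  rw [mem_near] at hc hd
  rcases o with _ | _ | _
  · rcases t <;>
      simp only [Op.kind, Kind.parity, Op.pull, Kind.ceil, Op.IsSite, Op.SiteInOct] at * <;>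
      omega
  · rcases t <;>
      simp only [Op.kind, Kind.flip, Kind.parity, Op.pull, Op.IsSite, Op.SiteInOct] at * <;>
      omega
  · exact absurd rfl hV

theorem pull_square {o : Op} {t : Kind} {P : ℕ} (hV : o ≠ .V) (h : Tight (o.kind t) P (2 * P)) :
    (o.pull t (P, 2 * P)).2 = 2 * (o.pull t (P, 2 * P)).1 := by
  obtain ⟨h1, h2, h3, h4⟩ := h
  rcases o with _ | _ | _
  · rcases t <;> simp only [Op.kind, Kind.parity, Op.pull, Kind.ceil] at * <;> omega
  · simp only [Op.pull]; omega
  · exact absurd rfl hV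

theorem exists_siteInOct {o : Op} {t : Kind} {P Q x y : ℕ} (h : Tight (o.kind t) P Q)
    (hx : x % 2 = t.parity) (hy : y % 2 = t.parity) (hx1 : x ≤ (o.pull t (P, Q)).1)
    (hy1 : y ≤ (o.pull t (P, Q)).1) (hxy : x + y ≤ (o.pull t (P, Q)).2) :
    ∃ a b, x ≤ a + 1 ∧ a ≤ x + 1 ∧ y ≤ b + 1 ∧ b ≤ y + 1 ∧ o.IsSite t a b ∧
      o.SiteInOct P Q a b := by
  obtain ⟨h1, h2, h3, h4⟩ := h
  rcases o with _ | _ | _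
  · simp only [Op.kind, Kind.parity, Op.pull, Kind.ceil, Op.IsSite, Op.SiteInOct, true_and] at *
    obtain ⟨n, rfl⟩ : ∃ n, P = 2 * n := ⟨P / 2, by omega⟩
    obtain ⟨k, rfl⟩ : ∃ k, Q = 2 * k := ⟨Q / 2, by omega⟩
    have hx2 : x ≤ n + 1 := by omega
    have hy2 : y ≤ n + 1 := by omega
    have hxy2 : x + y ≤ k + 2 := by omega
    clear hx hy hx1 hy1 hxy h1 h2
    by_cases hk : x + y = k + 2
    · exact ⟨x - 1, y - 1, by omega⟩
    · by_cases hxn : y ≤ x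
      · by_cases hyn : y = n + 1
        · exact ⟨x - 1, y - 1, by omega⟩
        · exact ⟨x - 1, y, by omega⟩
      · exact ⟨x, y - 1, by omega⟩
  -- The face is chosen towards the centre; from coordinate `0` the only odd neighbour is `1`.
  · refine ⟨if x = 0 then 1 else x - 1, if y = 0 then 1 else y - 1, ?_⟩
    rcases t <;>
      simp only [Op.kind, Kind.flip, Kind.parity, Op.pull, Op.IsSite, Op.SiteInOct] at * <;>
      split_ifs <;> omega
  · by_contra hcon
    simp only [not_exists] at hcon
    have i2 := hcon (x - 1) y
    have i3 := hcon x (y - 1)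
    -- At the centre both truncated subtractions give the non-site `(0, 0)`, and the edge `(1, 0)`
    -- is taken instead.
    have i4 := hcon (x + 1) y
    clear hcon
    rcases t <;>
      simp only [Op.kind, Kind.parity, Op.pull, Kind.ceil, Op.IsSite, Op.SiteInOct] at * <;>
      omega

/-- Converse of `near_inOct`: the pulled-back octagon contains no superfluous vertices. -/
theorem exists_site_inOct {o : Op} {t : Kind} {c : ℕ × ℕ} (h : Tight (o.kind t) c.1 c.2)
    {u : Cell m} (hu : IsVertex t u) (hio : InOct (o.pull t c).1 (o.pull t c).2 u) :
    ∃ w : Cell m, IsVertex (o.kind t) w ∧ InOct c.1 c.2 w ∧ u ∈ vertices t (o.site w) := by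
  obtain ⟨l, x, y, rfl⟩ := exists_eq_mk u
  have hu' := hu
  rw [isVertex_mk] at hu'
  rw [inOct_mk] at hio
  obtain ⟨a, b, h1, h2, h3, h4, hs, ho⟩ := exists_siteInOct h hu'.1 hu'.2 hio.1 hio.2.1 hio.2.2
  obtain ⟨w, hw, hsite, hw'⟩ := exists_site_eq_mk o t l hs
  exact ⟨w, hw, (hw' _ _).2 ho, hu, hsite ▸ touch_mk l h1 h2 h3 h4⟩

/-- The central element, where `midpointOf_mk` does not apply, is harmless: all its vertices are
inside every tight octagon. -/
theorem inOct_of_mem_vertices_center {t : Kind} {P Q : ℕ} (h : Tight t P Q) {u : Cell m}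
    (hu : u ∈ vertices t (center : Cell m)) : InOct P Q u := by
  obtain ⟨hv, ht⟩ := hu
  obtain ⟨h1, h2, h3, h4⟩ := h
  have hsup := ht.sup_le
  have hsum := ht.sum_le
  rw [isVertex_iff] at hv
  unfold InOct
  rcases t <;> simp only [Kind.parity, sup, sum, Cell.x, Cell.y] at * <;> omega

theorem isVertex_signed_near {t : Kind} (l : ZMod m) {a b : ℕ} (ha : 1 ≤ a) {c d : ℤ}
    (hc : c ∈ near t a) (hd : d ∈ near t b) : IsVertex t (signed l c.natAbs d) := by
  rw [mem_near] at hc hd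
  rw [isVertex_signed]
  omega

/-! ### Bounds for the weights -/

theorem near_nonempty (t : Kind) (b : ℤ) : (near t b).Nonempty := by
  unfold near
  split_ifs <;> simp

theorem nearMean_le {t : Kind} {b : ℤ} {f : ℤ → ℝ} {C : ℝ} (h : ∀ c ∈ near t b, f c ≤ C) :
    nearMean t b f ≤ C := by
  rw [nearMean, div_le_iff₀ (by exact_mod_cast (near_nonempty t b).card_pos), mul_comm,
    ← nsmul_eq_mul]
  exact Finset.sum_le_card_nsmul _ _ _ h

theorem nearMean_le_half {t : Kind} {b : ℤ} {f : ℤ → ℝ} {C : ℝ} (hb : b % 2 ≠ t.parity)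
    (h0 : ∀ c ∈ near t b, c ≤ b → f c ≤ 0) (h : ∀ c ∈ near t b, f c ≤ C) :
    nearMean t b f ≤ C / 2 := by
  have := t.parity_le
  rw [nearMean_of_not_parity hb]
  have h1 := h0 (b - 1) (mem_near.2 (by omega)) (by omega)
  have h2 := h (b + 1) (mem_near.2 (by omega))
  linarith

theorem midpointOf_nonpos [NeZero m] {t : Kind} {p : Cell m → ℝ} {z : Cell m}
    (h : ∀ u ∈ vertices t z, p u ≤ 0) : midpointOf t p z ≤ 0 := by
  rw [midpointOf_eq_sum]
  exact div_nonpos_of_nonpos_of_nonneg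
    (Finset.sum_nonpos fun u hu => h u (by simpa using hu)) (Nat.cast_nonneg _)

/-! ### Bounds for a single operator -/

section

variable {o : Op} {t : Kind} {c : ℕ × ℕ} {p : Cell m → ℝ} {C : ℝ} {w : Cell m}

theorem midpointOf_site_le_half (hm : 3 ≤ m) (h : Tight (o.kind t) c.1 c.2) (hC : 0 ≤ C)
    (hp : ∀ u, IsVertex t u → InOct ((o.pull t c).1 + 2) ((o.pull t c).2 + 2) u → p u ≤ C)
    (hp0 : ∀ u, IsVertex t u → InOct (o.pull t c).1 (o.pull t c).2 u → p u ≤ 0)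
    (hw : IsVertex (o.kind t) w) (hio : InOct (c.1 + 2) (c.2 + 2) w) :
    midpointOf t p (o.site w) ≤ C / 2 := by
  have : NeZero m := ⟨by omega⟩
  by_cases hc : w = center
  · rw [hc, site_center]
    refine (midpointOf_nonpos fun u hu => hp0 u hu.1 ?_).trans (by positivity)
    exact inOct_of_mem_vertices_center h.pull hu
  obtain ⟨l, a, b, ha, hsite, hs, ho⟩ := site_eq_mk o t hw hc
  rw [ho] at hio
  rw [hsite, midpointOf_mk hm t p l ha]
  have hC' : ∀ c' ∈ near t a, ∀ d ∈ near t b, p (signed l c'.natAbs d) ≤ C := fun c' hc' d hd =>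
    hp _ (isVertex_signed_near l ha hc' hd)
      ((inOct_signed _ _ _ _ _).2 (near_inOct_two h hs hio ha hc' hd))
  rcases half_near_inOct h hs hio ha with ⟨hat, hin⟩ | ⟨hbt, hin⟩ | hin
  · refine nearMean_le_half hat (fun c' hc' hca => nearMean_le fun d hd => ?_)
      (fun c' hc' => nearMean_le fun d hd => hC' c' hc' d hd)
    exact hp0 _ (isVertex_signed_near l ha hc' hd)
      ((inOct_signed _ _ _ _ _).2 (hin c' hc' hca d hd))
  · refine nearMean_le fun c' hc' => nearMean_le_half hbt (fun d hd hdb => ?_)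
      (fun d hd => hC' c' hc' d hd)
    exact hp0 _ (isVertex_signed_near l ha hc' hd)
      ((inOct_signed _ _ _ _ _).2 (hin c' hc' d hd hdb))
  · refine (nearMean_le fun c' hc' => nearMean_le fun d hd => ?_).trans (by positivity : 0 ≤ C / 2)
    exact hp0 _ (isVertex_signed_near l ha hc' hd)
      ((inOct_signed _ _ _ _ _).2 (hin c' hc' d hd))

theorem midpointOf_site_nonpos (hm : 3 ≤ m) (h : Tight (o.kind t) c.1 c.2)
    (hp0 : ∀ u, IsVertex t u → InOct (o.pull t c).1 (o.pull t c).2 u → p u ≤ 0)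
    (hw : IsVertex (o.kind t) w) (hio : InOct c.1 c.2 w) :
    midpointOf t p (o.site w) ≤ 0 := by
  have : NeZero m := ⟨by omega⟩
  by_cases hc : w = center
  · rw [hc, site_center]
    exact midpointOf_nonpos fun u hu => hp0 u hu.1 (inOct_of_mem_vertices_center h.pull hu)
  obtain ⟨l, a, b, ha, hsite, hs, ho⟩ := site_eq_mk o t hw hc
  rw [ho] at hio
  rw [hsite, midpointOf_mk hm t p l ha]
  refine nearMean_le fun c' hc' => nearMean_le fun d hd => ?_
  exact hp0 _ (isVertex_signed_near l ha hc' hd)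
    ((inOct_signed _ _ _ _ _).2 (near_inOct h hs hio ha hc' hd))

theorem midpointOf_site_nonpos_four (hm : 3 ≤ m) (h : Tight (o.kind t) c.1 c.2)
    (hp0 : ∀ u, IsVertex t u → InOct ((o.pull t c).1 + 2) ((o.pull t c).2 + 4) u → p u ≤ 0)
    (hw : IsVertex (o.kind t) w) (hio : InOct (c.1 + 2) (c.2 + 4) w) :
    midpointOf t p (o.site w) ≤ 0 := by
  have : NeZero m := ⟨by omega⟩
  by_cases hc : w = center
  · rw [hc, site_center]
    refine midpointOf_nonpos fun u hu => hp0 u hu.1 ?_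
    have := inOct_of_mem_vertices_center h.pull hu
    exact ⟨this.1.trans (by omega), this.2.trans (by omega)⟩
  obtain ⟨l, a, b, ha, hsite, hs, ho⟩ := site_eq_mk o t hw hc
  rw [ho] at hio
  rw [hsite, midpointOf_mk hm t p l ha]
  refine nearMean_le fun c' hc' => nearMean_le fun d hd => ?_
  exact hp0 _ (isVertex_signed_near l ha hc' hd)
    ((inOct_signed _ _ _ _ _).2 (near_inOct_four h hs hio ha hc' hd))

theorem midpointOf_site_nonpos_of_V (hm : 3 ≤ m) (h : Tight (Op.V.kind t) c.1 c.2)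
    (hp0 : ∀ u, IsVertex t u → InOct ((Op.V.pull t c).1 + 2) ((Op.V.pull t c).2 + 2) u → p u ≤ 0)
    (hw : IsVertex (Op.V.kind t) w) (hio : InOct (c.1 + 2) (c.2 + 4) w) :
    midpointOf t p (Op.V.site w) ≤ 0 := by
  have : NeZero m := ⟨by omega⟩
  by_cases hc : w = center
  · rw [hc, site_center]
    refine midpointOf_nonpos fun u hu => hp0 u hu.1 ?_
    have := inOct_of_mem_vertices_center h.pull hu
    exact ⟨this.1.trans (by omega), this.2.trans (by omega)⟩
  obtain ⟨l, a, b, ha, hsite, hs, ho⟩ := site_eq_mk Op.V t hw hc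
  rw [ho] at hio
  rw [hsite, midpointOf_mk hm t p l ha]
  refine nearMean_le fun c' hc' => nearMean_le fun d hd => ?_
  have h4 := near_inOct_four h hs hio ha hc' hd
  exact hp0 _ (isVertex_signed_near l ha hc' hd)
    ((inOct_signed _ _ _ _ _).2 ⟨h4.1, h4.2.1, near_inOct_of_V h hs hio ha hc' hd⟩)

theorem midpointOf_site_le_quarter (hm : 3 ≤ m) (h : Tight (o.kind t) c.1 c.2)
    (hsq : c.2 = 2 * c.1) (hV : o ≠ .V) (hC : 0 ≤ C)
    (hp : ∀ u, IsVertex t u → InOct ((o.pull t c).1 + 2) ((o.pull t c).2 + 4) u → p u ≤ C)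
    (hp0 : ∀ u, IsVertex t u → InOct ((o.pull t c).1 + 2) ((o.pull t c).2 + 2) u → p u ≤ 0)
    (hw : IsVertex (o.kind t) w) (hio : InOct (c.1 + 2) (c.2 + 4) w) :
    midpointOf t p (o.site w) ≤ C / 4 := by
  have : NeZero m := ⟨by omega⟩
  obtain ⟨P, Q⟩ := c
  simp only at hsq
  subst hsq
  by_cases hc : w = center
  · rw [hc, site_center]
    refine (midpointOf_nonpos fun u hu => hp0 u hu.1 ?_).trans (by positivity)
    have := inOct_of_mem_vertices_center h.pull hu
    exact ⟨this.1.trans (by omega), this.2.trans (by omega)⟩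
  obtain ⟨l, a, b, ha, hsite, hs, ho⟩ := site_eq_mk o t hw hc
  rw [ho] at hio
  rw [hsite, midpointOf_mk hm t p l ha]
  have hC' : ∀ c' ∈ near t a, ∀ d ∈ near t b, p (signed l c'.natAbs d) ≤ C := fun c' hc' d hd =>
    hp _ (isVertex_signed_near l ha hc' hd)
      ((inOct_signed _ _ _ _ _).2 (near_inOct_four h hs hio ha hc' hd))
  have h0 : ∀ c' ∈ near t a, ∀ d ∈ near t b, c' ≤ a ∨ d ≤ b → p (signed l c'.natAbs d) ≤ 0 :=
    fun c' hc' d hd hcd => hp0 _ (isVertex_signed_near l ha hc' hd) ((inOct_signed _ _ _ _ _).2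
      ⟨(near_inOct_four h hs hio ha hc' hd).1, (near_inOct_four h hs hio ha hc' hd).2.1,
        near_inOct_of_square hV h hs hio ha hc' hd hcd⟩)
  by_cases hat : (a : ℤ) % 2 = t.parity
  · refine (nearMean_le fun c' hc' => nearMean_le fun d hd => ?_).trans (by positivity : 0 ≤ C / 4)
    refine h0 c' hc' d hd (Or.inl ?_)
    rw [mem_near] at hc'
    omega
  by_cases hbt : (b : ℤ) % 2 = t.parity
  · refine (nearMean_le fun c' hc' => nearMean_le fun d hd => ?_).trans (by positivity : 0 ≤ C / 4)
    refine h0 c' hc' d hd (Or.inr ?_)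
    rw [mem_near] at hd
    omega
  have h4 : C / 4 = C / 2 / 2 := by ring
  rw [h4]
  exact nearMean_le_half hat
    (fun c' hc' hca => nearMean_le fun d hd => h0 c' hc' d hd (Or.inl hca))
    fun c' hc' => nearMean_le_half hbt (fun d hd hdb => h0 c' hc' d hd (Or.inr hdb)) (hC' c' hc')

end

/-! ### Bounds for a product of operators -/

section

variable {U : List Op} {t : Kind} {c : ℕ × ℕ} {p : Cell m → ℝ} {C : ℝ} {w : Cell m}

theorem applyOps_nonpos (hm : 3 ≤ m) (h : Tight (outKind U t) c.1 c.2)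
    (hp0 : ∀ u, IsVertex t u → InOct (pullOps U t c).1 (pullOps U t c).2 u → p u ≤ 0)
    (hw : IsVertex (outKind U t) w) (hio : InOct c.1 c.2 w) : applyOps U t p w ≤ 0 := by
  induction U generalizing t p with
  | nil => exact hp0 w hw hio
  | cons o U ih =>
    exact ih h (fun u hu hu' => midpointOf_site_nonpos hm (Tight.pullOps h) hp0 hu hu') hw

theorem applyOps_le (hm : 3 ≤ m) (h : Tight (outKind U t) c.1 c.2) (hC : 0 ≤ C)
    (hp : ∀ u, IsVertex t u →
      InOct ((pullOps U t c).1 + 2) ((pullOps U t c).2 + 2) u → p u ≤ C)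
    (hp0 : ∀ u, IsVertex t u → InOct (pullOps U t c).1 (pullOps U t c).2 u → p u ≤ 0)
    (hw : IsVertex (outKind U t) w) (hio : InOct (c.1 + 2) (c.2 + 2) w) :
    applyOps U t p w ≤ C / 2 ^ U.length := by
  induction U generalizing t p C with
  | nil => simpa [applyOps] using hp w hw hio
  | cons o U ih =>
    rw [List.length_cons, pow_succ', ← div_div]
    exact ih h (by positivity)
      (fun u hu hu' => midpointOf_site_le_half hm (Tight.pullOps h) hC hp hp0 hu hu')
      (fun u hu hu' => midpointOf_site_nonpos hm (Tight.pullOps h) hp0 hu hu') hw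

theorem applyOps_nonpos_four (hm : 3 ≤ m) (h : Tight (outKind U t) c.1 c.2)
    (hp0 : ∀ u, IsVertex t u →
      InOct ((pullOps U t c).1 + 2) ((pullOps U t c).2 + 4) u → p u ≤ 0)
    (hw : IsVertex (outKind U t) w) (hio : InOct (c.1 + 2) (c.2 + 4) w) :
    applyOps U t p w ≤ 0 := by
  induction U generalizing t p with
  | nil => exact hp0 w hw hio
  | cons o U ih =>
    exact ih h (fun u hu hu' => midpointOf_site_nonpos_four hm (Tight.pullOps h) hp0 hu hu') hw

theorem applyOps_nonpos_of_V (hm : 3 ≤ m) (hV : Op.V ∈ U) (h : Tight (outKind U t) c.1 c.2)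
    (hp0 : ∀ u, IsVertex t u →
      InOct ((pullOps U t c).1 + 2) ((pullOps U t c).2 + 2) u → p u ≤ 0)
    (hw : IsVertex (outKind U t) w) (hio : InOct (c.1 + 2) (c.2 + 4) w) :
    applyOps U t p w ≤ 0 := by
  induction U generalizing t p with
  | nil => simp at hV
  | cons o U ih =>
    rcases List.mem_cons.1 hV with rfl | hV
    -- From the first `V` on, the values are nonpositive on the whole octagon including the corners,
    -- and this persists.
    · exact applyOps_nonpos_four (U := U) (t := .dual) hm h
        (fun u hu hu' => midpointOf_site_nonpos_of_V hm (Tight.pullOps (U := U) h) hp0 hu hu') hw hio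
    · refine ih hV h (fun u hu hu' => ?_) hw
      -- With `C = 0` the halving bound says that nonpositivity on the margin of width two is
      -- preserved.
      refine (midpointOf_site_le_half hm (Tight.pullOps h) le_rfl hp0
        (fun x hx hx' => hp0 x hx ?_) hu hu').trans_eq (zero_div _)
      exact ⟨hx'.1.trans (Nat.le_add_right _ _), hx'.2.trans (Nat.le_add_right _ _)⟩

theorem pullOps_square (hV : Op.V ∉ U) (h : Tight (outKind U t) c.1 c.2) (hsq : c.2 = 2 * c.1) :
    (pullOps U t c).2 = 2 * (pullOps U t c).1 := by
  induction U generalizing t with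
  | nil => exact hsq
  | cons o U ih =>
    rw [List.mem_cons, not_or] at hV
    have hi := ih hV.2 h
    have ht : Tight (o.kind t) (pullOps U (o.kind t) c).1 (pullOps U (o.kind t) c).2 :=
      Tight.pullOps h
    have he : pullOps U (o.kind t) c =
        ((pullOps U (o.kind t) c).1, 2 * (pullOps U (o.kind t) c).1) := Prod.ext rfl hi
    rw [pullOps, he]
    exact pull_square (Ne.symm hV.1) (hi ▸ ht)

theorem applyOps_le_quarter (hm : 3 ≤ m) (hV : Op.V ∉ U) (h : Tight (outKind U t) c.1 c.2)
    (hsq : c.2 = 2 * c.1) (hC : 0 ≤ C)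
    (hp : ∀ u, IsVertex t u →
      InOct ((pullOps U t c).1 + 2) ((pullOps U t c).2 + 4) u → p u ≤ C)
    (hp0 : ∀ u, IsVertex t u →
      InOct ((pullOps U t c).1 + 2) ((pullOps U t c).2 + 2) u → p u ≤ 0)
    (hw : IsVertex (outKind U t) w) (hio : InOct (c.1 + 2) (c.2 + 4) w) :
    applyOps U t p w ≤ C / 4 ^ U.length := by
  induction U generalizing t p C with
  | nil => simpa [applyOps] using hp w hw hio
  | cons o U ih =>
    rw [List.mem_cons, not_or] at hV
    rw [List.length_cons, pow_succ', ← div_div]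
    refine ih hV.2 h (by positivity)
      (fun u hu hu' => midpointOf_site_le_quarter hm (Tight.pullOps h)
        (pullOps_square hV.2 h hsq) (Ne.symm hV.1) hC hp hp0 hu hu')
      (fun u hu hu' => ?_) hw
    refine (midpointOf_site_le_half hm (Tight.pullOps h) le_rfl hp0
      (fun x hx hx' => hp0 x hx ?_) hu hu').trans_eq (zero_div _)
    exact ⟨hx'.1.trans (Nat.le_add_right _ _), hx'.2.trans (Nat.le_add_right _ _)⟩

theorem exists_applyOps_pos [NeZero m] (h : Tight (outKind U t) c.1 c.2) (hp : ∀ u, 0 ≤ p u)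
    {u : Cell m} (hu : IsVertex t u) (hio : InOct (pullOps U t c).1 (pullOps U t c).2 u)
    (hpu : 0 < p u) :
    ∃ w, IsVertex (outKind U t) w ∧ InOct c.1 c.2 w ∧ 0 < applyOps U t p w := by
  induction U generalizing t p u with
  | nil => exact ⟨u, hu, hio, hpu⟩
  | cons o U ih =>
    obtain ⟨w, hw, hw', huw⟩ := exists_site_inOct (Tight.pullOps h) hu hio
    exact ih h (fun x => midpointOf_nonneg _ hp) hw hw' (midpointOf_pos hp huw hpu)

end

/-! ### The octagon of the core -/

/-- The parameters of the octagon of the central vertex or face. -/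
def Kind.start : Kind → ℕ × ℕ
  | .primal => (0, 0)
  | .dual => (1, 2)

theorem tight_start (t : Kind) : Tight t t.start.1 t.start.2 := by
  rcases t <;> constructor <;> simp [Kind.start, Kind.parity]

theorem monotone_pull (o : Op) (t : Kind) : Monotone (o.pull t) := by
  rintro ⟨P, Q⟩ ⟨P', Q'⟩ ⟨h1, h2⟩
  simp only at h1 h2
  rcases o <;> rcases t <;>
    refine Prod.mk_le_mk.2 ⟨?_, ?_⟩ <;> simp only [Kind.ceil, Kind.parity] <;> omega

theorem monotone_pullOps (U : List Op) (t : Kind) : Monotone (pullOps U t) := by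
  induction U generalizing t with
  | nil => exact monotone_id
  | cons o U ih => exact (monotone_pull o t).comp (ih _)

/-- The vertices of the central element influence the central element of the new mesh; hence the
iterates of `pullOps U t` from `t.start` increase when `U` preserves the kind. -/
theorem start_le_pullOps (U : List Op) (t : Kind) :
    t.start ≤ pullOps U t (outKind U t).start := by
  induction U generalizing t with
  | nil => exact le_rfl
  | cons o U ih =>
    refine le_trans ?_ (monotone_pull o t (ih (o.kind t)))
    rcases o <;> rcases t <;> decide

/-- The size of an octagon, which `R` and `V` reduce up to a constant. -/
noncomputable def octSize (c : ℕ × ℕ) : ℝ := max (√2 * c.1) c.2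

theorem octSize_nonneg (c : ℕ × ℕ) : 0 ≤ octSize c := le_max_of_le_right (Nat.cast_nonneg _)

/-- The factor `√2` balances the exchange of `P` and `Q` by `V`, whose main part is `(P, Q) ↦ (Q /
2, P)`. -/
theorem octSize_pull_le (o : Op) (t : Kind) (c : ℕ × ℕ) :
    octSize (o.pull t c) ≤ octSize c + 2 ∧
      (o ≠ .A → octSize (o.pull t c) ≤ √2 / 2 * octSize c + 2) := by
  have h2 : √2 * √2 = 2 := Real.mul_self_sqrt (by norm_num)
  have h0 : 1 ≤ √2 := Real.one_le_sqrt.2 (by norm_num)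
  have h1 : √2 ≤ 2 := by nlinarith
  have hP : √2 * c.1 ≤ octSize c := le_max_left _ _
  have hQ : (c.2 : ℝ) ≤ octSize c := le_max_right _ _
  have hn := octSize_nonneg c
  have hs : √2 / 2 * octSize c ≤ octSize c := by nlinarith
  have key : o ≠ .A → octSize (o.pull t c) ≤ √2 / 2 * octSize c + 2 := fun ho => by
    have hceil : ∀ n : ℕ, ((t.ceil (n / 2) : ℕ) : ℝ) ≤ n / 2 + 1 := fun n => by
      have : 2 * t.ceil (n / 2) ≤ n + 2 := by simp only [Kind.ceil]; omega
      have : (2 : ℝ) * (t.ceil (n / 2) : ℕ) ≤ n + 2 := by exact_mod_cast this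
      linarith
    rcases o with _ | _ | _
    · refine max_le ?_ ?_
      · have := hceil c.1
        simp only [Op.pull]
        nlinarith
      · have : 2 * (Op.R.pull t c).2 ≤ c.2 + 4 := by simp only [Op.pull]; omega
        have : (2 : ℝ) * ((Op.R.pull t c).2 : ℕ) ≤ c.2 + 4 := by exact_mod_cast this
        nlinarith
    · exact absurd rfl ho
    · refine max_le ?_ ?_
      · have := hceil c.2
        simp only [Op.pull]
        nlinarith
      · simp only [Op.pull]
        push_cast
        nlinarith
  refine ⟨?_, key⟩
  rcases o with _ | _ | _
  · exact (key (by simp)).trans (by linarith)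
  · refine max_le ?_ ?_ <;> simp only [Op.pull] <;> push_cast <;> linarith
  · exact (key (by simp)).trans (by linarith)

theorem exists_octSize_pullOps_le (U : List Op) :
    ∃ C, 0 ≤ C ∧ ∀ t c, octSize (pullOps U t c) ≤ octSize c + C := by
  induction U with
  | nil => exact ⟨0, le_rfl, fun t c => by simp [pullOps]⟩
  | cons o U ih =>
    obtain ⟨C, hC, h⟩ := ih
    refine ⟨C + 2, by linarith, fun t c => ?_⟩
    have h1 := (octSize_pull_le o t (pullOps U (o.kind t) c)).1
    have h2 := h (o.kind t) c
    rw [pullOps]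
    linarith

theorem exists_octSize_pullOps_le_mul {U : List Op} (hU : ∃ o ∈ U, o ≠ Op.A) :
    ∃ C, 0 ≤ C ∧ ∀ t c, octSize (pullOps U t c) ≤ √2 / 2 * octSize c + C := by
  have hs : √2 ≤ 2 := Real.sqrt_le_iff.2 (by norm_num)
  induction U with
  | nil => simp at hU
  | cons o U ih =>
    by_cases ho : o = .A
    · obtain ⟨C, hC, h⟩ := ih (by simpa [ho] using hU)
      refine ⟨C + 2, by linarith, fun t c => ?_⟩
      have h1 := (octSize_pull_le o t (pullOps U (o.kind t) c)).1
      have h2 := h (o.kind t) c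
      rw [pullOps]
      linarith
    · obtain ⟨C, hC, h⟩ := exists_octSize_pullOps_le U
      refine ⟨C + 2, by linarith, fun t c => ?_⟩
      have h1 := (octSize_pull_le o t (pullOps U (o.kind t) c)).2 ho
      have h2 := h (o.kind t) c
      rw [pullOps]
      have h3 := Real.sqrt_nonneg 2
      nlinarith

theorem exists_octSize_iterate_le {U : List Op} (hU : ∃ o ∈ U, o ≠ Op.A) (t : Kind)
    (c : ℕ × ℕ) : ∃ K, ∀ k, octSize ((pullOps U t)^[k] c) ≤ K := by
  obtain ⟨C, hC, h⟩ := exists_octSize_pullOps_le_mul hU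
  have hs : √2 < 2 := (Real.sqrt_lt' (by norm_num)).2 (by norm_num)
  have hs0 := Real.sqrt_nonneg 2
  have hpos : 0 < 1 - √2 / 2 := by linarith
  -- The second entry is the fixed point of the affine contraction `x ↦ √2 / 2 * x + C`.
  refine ⟨max (octSize c) (C / (1 - √2 / 2)), fun k => ?_⟩
  induction k with
  | zero => exact le_max_left _ _
  | succ k ih =>
    rw [Function.iterate_succ_apply']
    refine (h t _).trans ?_
    have hK := (div_le_iff₀ hpos).1 (le_max_right (octSize c) (C / (1 - √2 / 2)))
    nlinarith

theorem exists_pullOps_fixed {U : List Op} (hU : ∃ o ∈ U, o ≠ Op.A) {t : Kind}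
    (ht : outKind U t = t) :
    ∃ k, pullOps U t ((pullOps U t)^[k] t.start) = (pullOps U t)^[k] t.start := by
  obtain ⟨K, hK⟩ := exists_octSize_iterate_le hU t t.start
  have hmono : Monotone fun k => (pullOps U t)^[k] t.start := by
    refine (monotone_pullOps U t).monotone_iterate_of_le_map ?_
    simpa [ht] using start_le_pullOps U t
  by_contra! hne
  -- An increasing sequence of pairs that never repeats has a strictly increasing coordinate sum,
  -- which exceeds any bound.
  have hstrict : StrictMono fun k =>
      ((pullOps U t)^[k] t.start).1 + ((pullOps U t)^[k] t.start).2 := by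
    refine strictMono_nat_of_lt_succ fun k => ?_
    obtain ⟨h1, h2⟩ := hmono (Nat.le_add_right k 1)
    have h3 : (pullOps U t)^[k + 1] t.start ≠ (pullOps U t)^[k] t.start := by
      rw [Function.iterate_succ_apply']
      exact hne k
    simp only at h1 h2
    by_contra h4
    exact h3 (Prod.ext (by omega) (by omega))
  obtain ⟨n, hn⟩ := exists_nat_gt (2 * K)
  have h1 := hstrict.le_apply (x := n)
  have h2 := hK n
  have h3 : ((((pullOps U t)^[n] t.start).1 : ℕ) : ℝ) ≤ K := by
    refine le_trans ?_ ((le_max_left _ _).trans h2)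
    exact le_mul_of_one_le_left (Nat.cast_nonneg _) (Real.one_le_sqrt.2 (by norm_num))
  have h4 : ((((pullOps U t)^[n] t.start).2 : ℕ) : ℝ) ≤ K := (le_max_right _ _).trans h2
  have h5 : (n : ℝ) ≤ (((pullOps U t)^[n] t.start).1 : ℕ) + (((pullOps U t)^[n] t.start).2 : ℕ) := by
    exact_mod_cast h1
  linarith

theorem tight_iterate_pullOps {U : List Op} {t : Kind} (ht : outKind U t = t) (k : ℕ) :
    Tight t ((pullOps U t)^[k] t.start).1 ((pullOps U t)^[k] t.start).2 := by
  induction k with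
  | zero => exact tight_start t
  | succ k ih =>
    rw [Function.iterate_succ_apply']
    exact Tight.pullOps (ht.symm ▸ ih)

/-! ### The core and its first ring -/

theorem mem_vertices_center_of_inOct_start {t : Kind} {u : Cell m} (hu : IsVertex t u)
    (hio : InOct t.start.1 t.start.2 u) : u ∈ vertices t (center : Cell m) := by
  refine ⟨hu, ?_⟩
  obtain ⟨l, x, y, rfl⟩ := exists_eq_mk u
  rw [inOct_mk] at hio
  have h : x ≤ 1 ∧ y ≤ 1 := by rcases t <;> simp only [Kind.start] at hio <;> omega
  exact touch_mk (x' := 0) (y' := 0) l (by omega) (by omega) (by omega) (by omega)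

section

variable {U : List Op} {t : Kind}

theorem step_nonneg [NeZero m] {p : Cell m → ℝ} (h : ∀ u, 0 ≤ p u) (w : Cell m) :
    0 ≤ step U t p w := applyOps_nonneg _ _ h _

theorem iterate_step_nonneg [NeZero m] {p : Cell m → ℝ} (h : ∀ u, 0 ≤ p u) (k : ℕ) (w : Cell m) :
    0 ≤ (step U t)^[k] p w := by
  induction k generalizing p with
  | zero => exact h w
  | succ k ih => exact ih fun u => step_nonneg h u

open Classical in
theorem single_nonneg (u v : Cell m) : 0 ≤ (Pi.single u 1 : Cell m → ℝ) v := by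
  rw [Pi.single_apply]
  split_ifs <;> norm_num

open Classical in
theorem single_self_pos (u : Cell m) : 0 < (Pi.single u 1 : Cell m → ℝ) u := by
  rw [Pi.single_eq_same]
  exact one_pos

open Classical in
theorem single_nonpos {u v : Cell m} (h : v ≠ u) : (Pi.single u 1 : Cell m → ℝ) v ≤ 0 :=
  (Pi.single_eq_of_ne h _).le

theorem weight_nonneg [NeZero m] (k : ℕ) (w u : Cell m) : 0 ≤ weight U t k w u :=
  iterate_step_nonneg (single_nonneg u) k w

theorem iterate_step_nonpos (hm : 3 ≤ m) (ht : outKind U t = t) {c : ℕ × ℕ} (hc : Tight t c.1 c.2)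
    (hfix : pullOps U t c = c) {p : Cell m → ℝ}
    (hp : ∀ u, IsVertex t u → InOct c.1 c.2 u → p u ≤ 0) (k : ℕ) {w : Cell m}
    (hw : IsVertex t w) (hio : InOct c.1 c.2 w) : (step U t)^[k] p w ≤ 0 := by
  induction k generalizing p with
  | zero => exact hp w hw hio
  | succ k ih =>
    refine ih fun u hu hu' => ?_
    refine applyOps_nonpos (c := c) hm (ht.symm ▸ hc) (by rwa [hfix]) ?_ ?_
    · rwa [ht, isVertex_turn]
    · rwa [inOct_turn]

theorem exists_iterate_step_pos [NeZero m] (ht : outKind U t = t) (k : ℕ) {p : Cell m → ℝ}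
    (hp : ∀ u, 0 ≤ p u) {u : Cell m} (hu : IsVertex t u)
    (hio : InOct ((pullOps U t)^[k] t.start).1 ((pullOps U t)^[k] t.start).2 u) (hpu : 0 < p u) :
    ∃ w ∈ vertices t (center : Cell m), 0 < (step U t)^[k] p w := by
  induction k generalizing p u with
  | zero => exact ⟨u, mem_vertices_center_of_inOct_start hu hio, hpu⟩
  | succ k ih =>
    rw [Function.iterate_succ_apply'] at hio
    obtain ⟨w, hw, hw', hpos⟩ :=
      exists_applyOps_pos (ht.symm ▸ tight_iterate_pullOps ht k) hp hu hio hpu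
    refine ih (fun x => step_nonneg hp x)
      -- `step` evaluates at a turned label; turning back changes neither the kind nor the octagon.
      (u := turn (-((numV U / 2 : ℕ) : ZMod m)) w) ?_ ?_ ?_
    · rwa [isVertex_turn, ← ht]
    · rwa [inOct_turn]
    · rwa [step, turn_turn_neg]

theorem exists_core_eq (hm : 3 ≤ m) (hU : ∃ o ∈ U, o ≠ Op.A) (ht : outKind U t = t) :
    ∃ c : ℕ × ℕ, Tight t c.1 c.2 ∧ pullOps U t c = c ∧ (Op.V ∉ U → c.2 = 2 * c.1) ∧
      core m U t = {u | IsVertex t u ∧ InOct c.1 c.2 u} := by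
  have : NeZero m := ⟨by omega⟩
  obtain ⟨k, hk⟩ := exists_pullOps_fixed hU ht
  have hT := tight_iterate_pullOps ht k
  refine ⟨_, hT, hk, fun hV => ?_, ?_⟩
  · clear hk hT
    induction k with
    | zero => rcases t <;> rfl
    | succ k ih =>
      rw [Function.iterate_succ_apply']
      exact pullOps_square hV (ht.symm ▸ tight_iterate_pullOps ht k) ih
  · ext u
    constructor
    · rintro ⟨hu, n, -, w, hw, hne⟩
      refine ⟨hu, ?_⟩
      by_contra hio
      refine hne (le_antisymm ?_ (weight_nonneg n w u))
      refine iterate_step_nonpos hm ht hT hk (fun v _ hv' => single_nonpos ?_) n hw.1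
        (inOct_of_mem_vertices_center hT hw)
      rintro rfl
      exact hio hv'
    · rintro ⟨hu, hio⟩
      -- The stationary index may be `0`, but the core requires at least one step; stationarity
      -- allows `k + 1`.
      rw [← hk, ← Function.iterate_succ_apply' (pullOps U t)] at hio
      obtain ⟨w, hw, hw'⟩ :=
        exists_iterate_step_pos ht (k + 1) (single_nonneg u) hu hio (single_self_pos u)
      exact ⟨hu, k + 1, by omega, w, hw, hw'.ne'⟩

end

theorem mem_core_union_ring {t : Kind} {X : Set (Cell m)} {z x : Cell m} (hz : IsFace t z)
    (hx : x ∈ X) (hxz : x ∈ vertices t z) : vertices t z ⊆ X ∪ ring t X := fun u hu => by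
  by_cases h : u ∈ X
  · exact Or.inl h
  · exact Or.inr ⟨h, z, hz, hu, x, hx, hxz⟩

/-! ### Ring vertices and the faces at them -/

section

variable {t : Kind} {P Q : ℕ}

theorem ring_inOct {u : Cell m}
    (hu : u ∈ ring t {u : Cell m | IsVertex t u ∧ InOct P Q u}) :
    IsVertex t u ∧ ¬ InOct P Q u ∧ InOct (P + 2) (Q + 4) u := by
  obtain ⟨hn, z, -, huz, x, ⟨-, hx1, hx2⟩, hxz⟩ := hu
  refine ⟨huz.1, fun h => hn ⟨huz.1, h⟩, ?_, ?_⟩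
  · have h1 := huz.2.sup_le
    have h2 := hxz.2.symm.sup_le
    omega
  · have h1 := huz.2.sum_le
    have h2 := hxz.2.symm.sum_le
    omega

theorem faces_ncard_eq_one (h : Tight t P Q) {u : Cell m}
    (hu : u ∈ ring t {u : Cell m | IsVertex t u ∧ InOct P Q u})
    (hn : ¬ InOct (P + 2) (Q + 2) u) :
    {z : Cell m | IsFace t z ∧ u ∈ vertices t z ∧
      vertices t z ⊆ {u : Cell m | IsVertex t u ∧ InOct P Q u} ∪
        ring t {u : Cell m | IsVertex t u ∧ InOct P Q u}}.ncard = 1 := by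
  obtain ⟨hv, -, hio⟩ := ring_inOct hu
  obtain ⟨l, x, y, rfl⟩ := exists_eq_mk u
  have hv' := hv
  rw [isVertex_mk] at hv'
  rw [inOct_mk] at hn hio
  obtain ⟨h1, h2, h3, h4⟩ := h
  have hle := t.parity_le
  have hsum : x + y = Q + 4 := by omega
  obtain ⟨x, rfl⟩ : ∃ k, x = k + 2 := ⟨x - 2, by omega⟩
  obtain ⟨y, rfl⟩ : ∃ k, y = k + 2 := ⟨y - 2, by omega⟩
  rw [Set.ncard_eq_one]
  refine ⟨mk l (x + 1) (y + 1), Set.eq_singleton_iff_unique_mem.2 ⟨⟨?_, ⟨hv, ?_⟩, ?_⟩, ?_⟩⟩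
  · rw [IsFace, isVertex_mk, Kind.parity_flip]; omega
  · exact touch_mk l (by omega) (by omega) (by omega) (by omega)
  -- The face towards the centre has the core vertex `(x, y)`, with sum `Q`, diagonally opposite to
  -- the corner.
  · refine mem_core_union_ring (x := mk l x y) ?_ ⟨?_, ?_⟩ ⟨?_, ?_⟩
    · rw [IsFace, isVertex_mk, Kind.parity_flip]; omega
    · rw [isVertex_mk]; omega
    · rw [inOct_mk]; omega
    · rw [isVertex_mk]; omega
    · exact touch_mk l (by omega) (by omega) (by omega) (by omega)
  · rintro z ⟨hz, ⟨-, huz⟩, hsub⟩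
    -- Any other face at the corner has a vertex with sum `Q + 6`, which is beyond the ring.
    have hbd : ∀ x' y', IsVertex t (mk l x' y') → Touch (mk l x' y') z → x' + y' ≤ Q + 4 :=
      fun x' y' hv' ht' => by
        rcases hsub ⟨hv', ht'⟩ with h | h
        · have := h.2.2
          rw [sum_mk] at this
          omega
        · have := (ring_inOct h).2.2.2
          rwa [sum_mk] at this
    obtain ⟨c, hc, d, hd, rfl⟩ := (mem_vertices_mk (by omega)).1
      (⟨hz, huz.symm⟩ : z ∈ vertices t.flip (mk l (x + 2) (y + 2)))
    rw [mem_near, Kind.parity_flip] at hc hd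
    obtain ⟨d, rfl⟩ : ∃ k : ℕ, d = k := ⟨d.toNat, by omega⟩
    obtain ⟨c, rfl⟩ : ∃ k : ℕ, c = k := ⟨c.toNat, by omega⟩
    simp only [Int.natAbs_natCast, signed_natCast] at *
    have hc' : c = x + 1 := by
      by_contra hne
      have := hbd (x + 4) (y + 2) (by rw [isVertex_mk]; omega)
        (touch_mk l (by omega) (by omega) (by omega) (by omega))
      omega
    have hd' : d = y + 1 := by
      by_contra hne
      have := hbd (x + 2) (y + 4) (by rw [isVertex_mk]; omega)
        (touch_mk l (by omega) (by omega) (by omega) (by omega))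
      omega
    rw [hc', hd']

theorem faces_ncard_ne_one (hm : 3 ≤ m) (h : Tight t P Q) {u : Cell m}
    (hu : u ∈ ring t {u : Cell m | IsVertex t u ∧ InOct P Q u})
    (hio : InOct (P + 2) (Q + 2) u) :
    {z : Cell m | IsFace t z ∧ u ∈ vertices t z ∧
      vertices t z ⊆ {u : Cell m | IsVertex t u ∧ InOct P Q u} ∪
        ring t {u : Cell m | IsVertex t u ∧ InOct P Q u}}.ncard ≠ 1 := by
  obtain ⟨hv, hn, -⟩ := ring_inOct hu
  rcases eq_center_or_mk u with rfl | ⟨l, x, y, hx, rfl⟩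
  · exact absurd (inOct_center P Q) hn
  have hv' := hv
  rw [isVertex_mk] at hv'
  rw [inOct_mk] at hn hio
  obtain ⟨h1, h2, h3, h4⟩ := h
  have hle := t.parity_le
  suffices H : ∃ (c c' : ℕ) (d d' : ℤ), (c ≠ c' ∨ d ≠ d') ∧ -1 ≤ d ∧ -1 ≤ d' ∧
      ∃ a b, a ≤ P ∧ b ≤ P ∧ a + b ≤ Q ∧ a % 2 = t.parity ∧ b % 2 = t.parity ∧
      ∀ (e : ℕ) (f : ℤ), (e = c ∧ f = d ∨ e = c' ∧ f = d') →
        e % 2 = 1 - t.parity ∧ f.natAbs % 2 = 1 - t.parity ∧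
        x ≤ e + 1 ∧ e ≤ x + 1 ∧ f ≤ y + 1 ∧ y ≤ f + 1 ∧
        a ≤ e + 1 ∧ e ≤ a + 1 ∧ f ≤ b + 1 ∧ b ≤ f + 1 by
    obtain ⟨c, c', d, d', hne, hd, hd', a, b, ha, hb, hab, ha2, hb2, hef⟩ := H
    have hmem : ∀ (e : ℕ) (f : ℤ), (e = c ∧ f = d ∨ e = c' ∧ f = d') →
        signed l e f ∈ {z : Cell m | IsFace t z ∧ mk l x y ∈ vertices t z ∧
          vertices t z ⊆ {u : Cell m | IsVertex t u ∧ InOct P Q u} ∪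
            ring t {u : Cell m | IsVertex t u ∧ InOct P Q u}} := fun e f hh => by
      obtain ⟨i1, i2, i3, i4, i5, i6, i7, i8, i9, i10⟩ := hef e f hh
      have hface : IsFace t (signed l e f) := by
        rw [IsFace, isVertex_signed, Kind.parity_flip]
        exact ⟨i1, i2⟩
      refine ⟨hface, ⟨hv, (touch_signed l i3 i4 i5 i6).symm⟩, ?_⟩
      have hab' : IsVertex t (mk l a b) := (isVertex_mk _ _ _ _).2 ⟨ha2, hb2⟩
      exact mem_core_union_ring hface ⟨hab', (inOct_mk _ _ _ _ _).2 ⟨ha, hb, hab⟩⟩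
        ⟨hab', (touch_signed l i7 i8 i9 i10).symm⟩
    intro hcard
    obtain ⟨z, hz⟩ := Set.ncard_eq_one.1 hcard
    have e1 := hmem c d (Or.inl ⟨rfl, rfl⟩)
    have e2 := hmem c' d' (Or.inr ⟨rfl, rfl⟩)
    rw [hz, Set.mem_singleton_iff] at e1 e2
    have := signed_inj hm hd hd' (e1.trans e2.symm)
    omega
  by_cases hxy : y ≤ x
  -- The two faces on the inner side of the larger coordinate share the core vertex obtained by
  -- decreasing that coordinate by two. For `y = 0` one of them lies in the preceding quadrant.
  · refine ⟨x - 1, x - 1, y - 1, y + 1, Or.inr (by omega), by omega, by omega, x - 2, y, ?_⟩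
    refine ⟨by omega, by omega, by omega, by omega, by omega, fun e f hh => ?_⟩
    omega
  · refine ⟨x - 1, x + 1, y - 1, y - 1, Or.inl (by omega), by omega, by omega, x, y - 2, ?_⟩
    refine ⟨by omega, by omega, by omega, by omega, by omega, fun e f hh => ?_⟩
    omega

end

/-! ### Spectral radii -/

/-- Gershgorin: an eigenvalue differs from some diagonal entry by at most the remaining absolute row
sum. -/
theorem matrixSpectralRadius_le {ι : Type*} [Fintype ι] (M : Matrix ι ι ℝ) {C : ℝ}
    (h : ∀ i, ∑ j, |M i j| ≤ C) : matrixSpectralRadius M ≤ ENNReal.ofReal C := by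
  classical
  have key : spectralRadius ℂ (M.map ((↑) : ℝ → ℂ)) ≤ ENNReal.ofReal C := by
    refine iSup₂_le fun μ hμ => ?_
    rw [← Matrix.spectrum_toLin', ← Module.End.hasEigenvalue_iff_mem_spectrum] at hμ
    obtain ⟨k, hk⟩ := eigenvalue_mem_ball hμ
    rw [mem_closedBall_iff_norm] at hk
    have h1 := h k
    rw [← Finset.add_sum_erase _ _ (Finset.mem_univ k)] at h1
    simp only [Matrix.map_apply, Complex.norm_real, Real.norm_eq_abs] at hk
    have h2 := norm_le_norm_add_norm_sub' μ ((M k k : ℝ) : ℂ)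
    rw [Complex.norm_real, Real.norm_eq_abs] at h2
    rw [← ENNReal.ofReal_coe_nnreal, coe_nnnorm]
    exact ENNReal.ofReal_le_ofReal (by linarith)
  unfold matrixSpectralRadius
  -- The definition chooses its own `Fintype` and `DecidableEq` instances; `convert` identifies
  -- them.
  convert key

open Classical in
theorem sum_single_of_mem (X : Set (Cell m)) [Fintype X] {v : Cell m} (hv : v ∈ X) :
    ∑ u : X, (Pi.single u.1 1 : Cell m → ℝ) v = 1 := by
  rw [Finset.sum_eq_single ⟨v, hv⟩]
  · simp
  · intro b _ hb
    rw [Pi.single_eq_of_ne]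
    rintro rfl
    exact hb rfl
  · simp

open Classical in
theorem sum_single_of_notMem (X : Set (Cell m)) [Fintype X] {v : Cell m} (hv : v ∉ X) :
    ∑ u : X, (Pi.single u.1 1 : Cell m → ℝ) v = 0 := by
  refine Finset.sum_eq_zero fun b _ => ?_
  rw [Pi.single_eq_of_ne]
  rintro rfl
  exact hv b.2

open Classical in
-- As the weights are nonnegative, linearity makes a row sum the value of one step on the indicator
-- of `X`; only one-sided bounds on this indicator are needed.
theorem matrixSpectralRadius_subdivisionBlock_le [NeZero m] (U : List Op) (t : Kind)
    (X : Set (Cell m)) [Finite X] {C : ℝ}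
    (h : ∀ p : Cell m → ℝ, (∀ v, p v ≤ 1) → (∀ v, v ∉ X → p v ≤ 0) →
      ∀ w ∈ X, step U t p w ≤ C) :
    matrixSpectralRadius (subdivisionBlock U t X) ≤ ENNReal.ofReal C := by
  have := Fintype.ofFinite X
  refine matrixSpectralRadius_le _ fun w => ?_
  have hsum : ∑ u : X, |subdivisionBlock U t X w u| =
      step U t (fun v => ∑ u : X, (Pi.single u.1 1 : Cell m → ℝ) v) w := by
    rw [step, applyOps_sum]
    exact Finset.sum_congr rfl fun u _ => abs_of_nonneg (weight_nonneg 1 w.1 u.1)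
  rw [hsum]
  refine h _ (fun v => ?_) (fun v hv => (sum_single_of_notMem X hv).le) w w.2
  by_cases hv : v ∈ X
  · exact (sum_single_of_mem X hv).le
  · exact (sum_single_of_notMem X hv).trans_le zero_le_one

/-! ### The factors of the operator -/

section

variable {s : ℕ} (a v r : Fin s → ℕ)

theorem length_midpointScheme :
    (midpointScheme a v r).length = ∑ i, r i + ∑ i, v i + ∑ i, a i := by
  rw [midpointScheme, List.length_flatMap, ← Finset.sum_add_distrib, ← Finset.sum_add_distrib,
    Fin.sum_univ_def]
  simp [add_assoc]

theorem V_mem_midpointScheme : Op.V ∈ midpointScheme a v r ↔ 0 < ∑ i, v i := by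
  simp [midpointScheme, List.mem_flatMap, List.mem_replicate, Nat.pos_iff_ne_zero]

theorem exists_mem_midpointScheme (h : 1 ≤ (∑ i, v i) + ∑ i, r i) :
    ∃ o ∈ midpointScheme a v r, o ≠ Op.A := by
  rw [← Finset.sum_add_distrib] at h
  obtain ⟨i, -, hi⟩ := Finset.exists_ne_zero_of_sum_ne_zero (Nat.one_le_iff_ne_zero.1 h)
  by_cases hv : v i = 0
  · refine ⟨Op.R, ?_, by simp⟩
    simp only [midpointScheme, List.mem_flatMap]
    exact ⟨i, List.mem_finRange i, by simp; omega⟩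
  · refine ⟨Op.V, ?_, by simp⟩
    simp only [midpointScheme, List.mem_flatMap]
    exact ⟨i, List.mem_finRange i, by simp [hv]⟩

end

end MidpointSubdivision

/-! ### The spectral radii of the two blocks -/

open MidpointSubdivision
theorem mainTheorem8 (m : ℕ) (hm : 3 ≤ m) (s : ℕ) (a v r : Fin s → ℕ)
    (hav : 1 ≤ (∑ i, a i) + ∑ i, v i) (hvr : 1 ≤ (∑ i, v i) + ∑ i, r i)
    (hv : Even (∑ i, v i))
    (t : Kind) (ht : outKind (midpointScheme a v r) t = t) :
    ∃ (_ : Finite (nonCorners m (midpointScheme a v r) t))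
      (_ : Finite (convexCorners m (midpointScheme a v r) t)),
      let ρB := matrixSpectralRadius
        (subdivisionBlock (midpointScheme a v r) t (nonCorners m (midpointScheme a v r) t))
      let ρA := matrixSpectralRadius
        (subdivisionBlock (midpointScheme a v r) t (convexCorners m (midpointScheme a v r) t))
      let σ := scalingFactor (∑ i, r i) (∑ i, v i)
      ρB ≤ ENNReal.ofReal
        ((2 : ℝ) ^ (-((∑ i, r i : ℕ) : ℝ) - ((∑ i, a i : ℕ) : ℝ) - ((∑ i, v i : ℕ) : ℝ))) ∧
      (∑ i, v i = 0 → ρA ≤ ENNReal.ofReal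
        ((4 : ℝ) ^ (-((∑ i, r i : ℕ) : ℝ) - ((∑ i, a i : ℕ) : ℝ)))) ∧
      (0 < ∑ i, v i → ρA = 0) ∧
      ρB ≤ ENNReal.ofReal σ ∧ ρA ≤ ENNReal.ofReal σ := by
  have : NeZero m := ⟨by omega⟩
  set U := midpointScheme a v r with hU
  have hlen : U.length = ∑ i, r i + ∑ i, v i + ∑ i, a i := length_midpointScheme a v r
  have hVmem : Op.V ∈ U ↔ 0 < ∑ i, v i := V_mem_midpointScheme a v r
  obtain ⟨c, hc, hfix, hsq, hcore⟩ := exists_core_eq hm (exists_mem_midpointScheme a v r hvr) ht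
  have hc' : Tight (outKind U t) c.1 c.2 := ht.symm ▸ hc
  have hring : ∀ u ∈ coreRing m U t, IsVertex t u ∧ ¬ InOct c.1 c.2 u ∧
      InOct (c.1 + 2) (c.2 + 4) u := fun u hu => by
    rw [coreRing, hcore] at hu
    exact ring_inOct hu
  have hcorner : ∀ u ∈ convexCorners m U t, u ∈ coreRing m U t ∧
      ¬ InOct (c.1 + 2) (c.2 + 2) u := fun u hu => by
    refine ⟨hu.1, fun hio => ?_⟩
    have h1 := hu.1
    have h2 := hu.2
    rw [coreRing, hcore] at h1 h2
    exact faces_ncard_ne_one hm hc h1 hio h2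
  have hnon : ∀ u ∈ nonCorners m U t, u ∈ coreRing m U t ∧
      InOct (c.1 + 2) (c.2 + 2) u := fun u hu => by
    refine ⟨hu.1, ?_⟩
    by_contra hio
    have h1 := hu.1
    refine hu.2 ⟨h1, ?_⟩
    rw [coreRing, hcore] at h1 ⊢
    exact faces_ncard_eq_one hc h1 hio
  have hfin : (coreRing m U t).Finite :=
    (Cell.finite_sup_le (c.1 + 2)).subset fun u hu => (hring u hu).2.2.1
  have hfinB : Finite (nonCorners m U t) := hfin.subset fun u hu => hu.1
  have hfinA : Finite (convexCorners m U t) := hfin.subset fun u hu => hu.1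
  have hB : matrixSpectralRadius (subdivisionBlock U t (nonCorners m U t)) ≤
      ENNReal.ofReal (1 / 2 ^ U.length) := by
    refine matrixSpectralRadius_subdivisionBlock_le U t _ fun p hp1 hp0 w hw => ?_
    obtain ⟨hwr, hwio⟩ := hnon w hw
    refine applyOps_le hm hc' zero_le_one (fun u _ _ => hp1 u) (fun u hu hio => hp0 u fun h => ?_)
      (by rw [ht, isVertex_turn]; exact (hring w hwr).1) (by rwa [inOct_turn])
    rw [hfix] at hio
    exact (hring u (hnon u h).1).2.1 hio
  have hA0 : ∑ i, v i = 0 → matrixSpectralRadius (subdivisionBlock U t (convexCorners m U t)) ≤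
      ENNReal.ofReal (1 / 4 ^ U.length) := fun h0 => by
    have hV : Op.V ∉ U := fun h => by
      have := hVmem.1 h
      omega
    refine matrixSpectralRadius_subdivisionBlock_le U t _ fun p hp1 hp0 w hw => ?_
    obtain ⟨hwr, -⟩ := hcorner w hw
    refine applyOps_le_quarter hm hV hc' (hsq hV) zero_le_one (fun u _ _ => hp1 u)
      (fun u hu hio => hp0 u fun h => ?_)
      (by rw [ht, isVertex_turn]; exact (hring w hwr).1)
      (by rw [inOct_turn]; exact (hring w hwr).2.2)
    rw [hfix] at hio
    exact (hcorner u h).2 hio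
  have hApos : 0 < ∑ i, v i →
      matrixSpectralRadius (subdivisionBlock U t (convexCorners m U t)) = 0 := fun h0 => by
    rw [← nonpos_iff_eq_zero, ← ENNReal.ofReal_zero]
    refine matrixSpectralRadius_subdivisionBlock_le U t _ fun p hp1 hp0 w hw => ?_
    obtain ⟨hwr, -⟩ := hcorner w hw
    refine applyOps_nonpos_of_V hm (hVmem.2 h0) hc' (fun u hu hio => hp0 u fun h => ?_)
      (by rw [ht, isVertex_turn]; exact (hring w hwr).1)
      (by rw [inOct_turn]; exact (hring w hwr).2.2)
    rw [hfix] at hio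
    exact (hcorner u h).2 hio
  rw [hlen] at hB hA0
  clear_value U
  generalize ∑ i, r i = r' at *
  generalize ∑ i, v i = v' at *
  generalize ∑ i, a i = a' at *
  have hpow2 : (1 : ℝ) / 2 ^ (r' + v' + a') = (2 : ℝ) ^ (-(r' : ℝ) - (a' : ℝ) - (v' : ℝ)) := by
    rw [one_div, ← Real.rpow_natCast, ← Real.rpow_neg (by norm_num)]
    congr 1
    push_cast
    ring
  have hpow4 : v' = 0 → (1 : ℝ) / 4 ^ (r' + v' + a') = (4 : ℝ) ^ (-(r' : ℝ) - (a' : ℝ)) := by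
    rintro rfl
    rw [one_div, ← Real.rpow_natCast, ← Real.rpow_neg (by norm_num)]
    congr 1
    push_cast
    ring
  have ha0 : (0 : ℝ) ≤ a' := Nat.cast_nonneg _
  have hv0 : (0 : ℝ) ≤ v' := Nat.cast_nonneg _
  have hr0 : (0 : ℝ) ≤ r' := Nat.cast_nonneg _
  refine ⟨hfinB, hfinA, hpow2 ▸ hB, fun h0 => hpow4 h0 ▸ hA0 h0, hApos, ?_, ?_⟩
  · refine hB.trans (ENNReal.ofReal_le_ofReal ?_)
    rw [hpow2, scalingFactor]
    exact Real.rpow_le_rpow_of_exponent_le (by norm_num) (by linarith)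
  · rcases Nat.eq_zero_or_pos v' with h0 | h0
    · refine (hA0 h0).trans (ENNReal.ofReal_le_ofReal ?_)
      rw [hpow4 h0, scalingFactor, h0]
      -- In base two the exponent is `-2 * r - 2 * a`, at most `-r`.
      have h4 : (4 : ℝ) = 2 ^ (2 : ℝ) := by norm_num
      rw [h4, ← Real.rpow_mul (by norm_num)]
      exact Real.rpow_le_rpow_of_exponent_le (by norm_num) (by push_cast; linarith)
    · rw [hApos h0]
      exact zero_le
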